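/- \textbf{Setting.} Let $(K,d)$ be a complete metric space. A countable Markov system $\mathcal M=(K_{i(e)},w_e,p_e)_{e\in E}$ on $K$ consists of: countable sets $E$ and $N$; a partition $(K_j)_{j\in N}$ of $K$ into non-empty Borel sets; a surjective map $i:E\to N$ and a map $t:E\to N$; Borel maps $w_e:K_{i(e)}\to K_{t(e)}$ and $p_e:K_{i(e)}\to[0,1]$, where $p_e$ is not identically zero, such that $\sum_{e:\,i(e)=j}p_e(y)=1$ for all $y\in K_j$, $j\in N$. Extend $p_e$ to $K$ by zero and $w_e$ to a Borel map on $K$ arbitrarily, and put $Uf=\sum_{e\in E}p_e\,f\circ w_e$. Let $P(\mathcal M)$ be the set of invariant measures, i.e. of Borel probability measures $\mu$ on $K$ with $\int Uf\,d\mu=\int f\,d\mu$ for all bounded Borel $f:K\to[0,\infty)$. $\mathcal M$ is \emph{contractive} if there is $a\in(0,1)$ with $\sum_{e:\,i(e)=j}p_e(x)\,d(w_ex,w_ey)\le a\,d(x,y)$ for all $x,y\in K_j$, $j\in N$; it is \emph{uniformly continuous} if all restrictions $w_e|_{K_{i(e)}}$ and $p_e|_{K_{i(e)}}$ are uniformly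 continuous. It has a \emph{dominating Markov chain} if $\xi_j:=\sum_{e:\,i(e)=j}\sup_{K_j}p_e<\infty$ for all $j\in N$; then set $q_{jk}:=\xi_j^{-1}\sum_{e:\,i(e)=j,\,t(e)=k}\sup_{K_j}p_e$ and $c:=\sum_{k\in N}\sup_{j\in N}\xi_jq_{jk}$. Fix points $x_j\in K_j$, $j\in N$, and set $b:=\sup_{j\in N}\sup_{x\in K_j}\sum_{e:\,i(e)=j}p_e(x)\,d(w_e(x_{i(e)}),x_{t(e)})$. Let $\bar E=E\cup\{\infty\}$ be the one-point compactification of the discrete space $E$, with $w_\infty=\mathrm{id}$ and $i(\infty)=t(\infty)$ a fixed vertex, let $\bar\Sigma=\bar E^{\mathbb Z}$ with its Borel $\sigma$-algebra, let $S$ be the left shift, let $\Sigma_G=\{\sigma\in\bar\Sigma:\ \sigma_n\in E,\ i(\sigma_{n+1})=t(\sigma_n)\ \forall n\in\mathbb Z\}$, and let $\mathcal F$ be the $\sigma$-algebra generated by the cylinder sets $\{\sigma:\ \sigma_m=e_m,\dots,\sigma_0=e_0\}$, $m\le0$. Let $D$ be the set of all $\sigma\in\Sigma_G$ for which $\lim_{m\to-\infty}w_{\sigma_0}\circ\dots\circ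 w_{\sigma_m}(x_{i(\sigma_m)})$ exists; let $F(\sigma)$ be this limit for $\sigma\in D$ and $F(\sigma)=x_{t(\sigma_0)}$ otherwise. For uniformly continuous $\mathcal M$, let $\bar p_e$ be the continuous extension of $p_e|_{K_{i(e)}}$ to $\overline{K_{i(e)}}$, extended by zero to $K$, let $T_j=\{\sigma\in\Sigma_G:\ t(\sigma_0)=j\}$, and let $\tilde E(\mathcal M)$ be the set of all $S$-invariant Borel probability measures $\Lambda$ on $\bar\Sigma$ with $\Lambda(D)=1$ and $E_\Lambda(1_{\{\sigma_1=e\}}\mid\mathcal F)=(\bar p_e\circ F)\,1_{T_{i(e)}}$ $\Lambda$-a.e. for all $e\in E$. $\mathcal M$ is \emph{consistent} if the image measure $F(\Lambda)$ belongs to $P(\mathcal M)$ for every $\Lambda\in\tilde E(\mathcal M)$. \textbf{Statement.} Suppose that $\mathcal M$ is contractive, uniformly continuous and has a dominating Markov chain, and that, for some choice of the points $x_j\in K_j$, it is consistent and $b<\infty$. If $c<\infty$, then $P(\mathcal M)\neq\emptyset$, i.e. $\mathcal M$ has an invariant Borel probability measure. In particular, $P(\mathcal M)\neq\emptyset$ whenever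 the partition is finite, i.e. $N$ is finite. -/

import Mathlib

open MeasureTheory Filter Topology Set
open scoped ENNReal NNReal

noncomputable section

namespace RandomMarkov

universe u v w

/-- A countable Markov system on a complete metric space `K` with (countable) edge set `E` and
(countable) vertex set `N`. The maps and probability functions are already extended to all of `K`:
the probability functions by zero, and the maps by arbitrary Borel measurable extensions. -/
structure MarkovSystem (K : Type u) [MetricSpace K] [MeasurableSpace K]
    (E : Type v) (N : Type w) where
  /-- the vertex sets `K_j` -/
  part : N → Set K
  /-- a distinguished vertex (the vertex `1`), only used as a default value at `∞` -/
  base : N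
  /-- initial vertex of an edge -/
  i : E → N
  /-- terminal vertex of an edge -/
  t : E → N
  /-- the maps -/
  w : E → K → K
  /-- the probability functions -/
  p : E → K → ℝ
  part_measurable : ∀ j, MeasurableSet (part j)
  part_nonempty : ∀ j, (part j).Nonempty
  part_disjoint : ∀ j k, j ≠ k → Disjoint (part j) (part k)
  part_cover : ⋃ j, part j = Set.univ
  i_surjective : Function.Surjective i
  w_measurable : ∀ e, Measurable (w e)
  w_mapsTo : ∀ e, Set.MapsTo (w e) (part (i e)) (part (t e))
  p_measurable : ∀ e, Measurable (p e)
  p_nonneg : ∀ e x, 0 ≤ p e x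
  p_le_one : ∀ e x, p e x ≤ 1
  p_eq_zero : ∀ e x, x ∉ part (i e) → p e x = 0
  p_nontrivial : ∀ e, ∃ x ∈ part (i e), 0 < p e x
  p_sum : ∀ j, ∀ y ∈ part j, HasSum (fun e : {e : E // i e = j} => p e.1 y) 1

/-- One-point compactification of the discrete space `E`; its Borel σ-algebra consists of all
subsets when `E` is countable. -/
abbrev ExtAlphabet (E : Type v) : Type v := OnePoint E

instance extAlphabetMeasurableSpace (E : Type v) : MeasurableSpace (OnePoint E) := ⊤

/-- The code space of two-sided sequences, with the product σ-algebra
(for countable `E`, this is the Borel σ-algebra of the product topology). -/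
abbrev CodeSpace (E : Type v) : Type v := ℤ → ExtAlphabet E

/-- The left shift. -/
def shift {E : Type v} (σ : CodeSpace E) : CodeSpace E := fun n => σ (n + 1)

/-- The σ-algebra of the past: it is generated by the cylinder sets
`{σ | σ_m = e_m, …, σ_0 = e_0}`, `m ≤ 0`. -/
@[reducible] def past (E : Type v) : MeasurableSpace (CodeSpace E) :=
  MeasurableSpace.generateFrom
    {C | ∃ m : ℤ, m ≤ 0 ∧ ∃ e : CodeSpace E,
      C = {σ : CodeSpace E | ∀ k : ℤ, m ≤ k → k ≤ 0 → σ k = e k}}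

namespace MarkovSystem

variable {K : Type u} [MetricSpace K] [MeasurableSpace K] {E : Type v} {N : Type w}

/-- The Markov operator `U f = ∑ₑ pₑ · f ∘ wₑ`. -/
def U (M : MarkovSystem K E N) (f : K → ℝ≥0∞) (x : K) : ℝ≥0∞ :=
  ∑' e, ENNReal.ofReal (M.p e x) * f (M.w e x)

/-- The set `P(M)` of invariant Borel probability measures: those `μ` with
`∫ U f dμ = ∫ f dμ` for all bounded nonnegative real-valued Borel functions `f`. -/
def invariantMeasures (M : MarkovSystem K E N) : Set (Measure K) :=
  {μ | IsProbabilityMeasure μ ∧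
    ∀ f : K → ℝ≥0, Measurable f → (∃ C : ℝ≥0, ∀ x, f x ≤ C) →
      ∫⁻ x, M.U (fun y => (f y : ℝ≥0∞)) x ∂μ = ∫⁻ x, (f x : ℝ≥0∞) ∂μ}

/-- Contraction on average with rate `a ∈ (0,1)` on every vertex set. -/
def Contractive (M : MarkovSystem K E N) : Prop :=
  ∃ a : ℝ, 0 < a ∧ a < 1 ∧ ∀ j, ∀ x ∈ M.part j, ∀ y ∈ M.part j,
    ∑' e : {e : E // M.i e = j}, ENNReal.ofReal (M.p e.1 x) * edist (M.w e.1 x) (M.w e.1 y)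
      ≤ ENNReal.ofReal a * edist x y

/-- Uniform continuity of all restrictions of maps and probability functions to the vertex sets. -/
def IsUniformlyContinuous (M : MarkovSystem K E N) : Prop :=
  ∀ e, UniformContinuousOn (M.w e) (M.part (M.i e)) ∧
    UniformContinuousOn (M.p e) (M.part (M.i e))

/-- The constant `b`, for a choice `pt` of reference points `x_j ∈ K_j`. -/
def b (M : MarkovSystem K E N) (pt : N → K) : ℝ≥0∞ :=
  ⨆ j : N, ⨆ x ∈ M.part j, ∑' e : {e : E // M.i e = j},
    ENNReal.ofReal (M.p e.1 x) * edist (M.w e.1 (pt (M.i e.1))) (pt (M.t e.1))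

/-- `sup_{x ∈ K_{i(e)}} pₑ(x)`. -/
def supProb (M : MarkovSystem K E N) (e : E) : ℝ≥0∞ :=
  ⨆ x ∈ M.part (M.i e), ENNReal.ofReal (M.p e x)

/-- `ξ_j`. -/
def xi (M : MarkovSystem K E N) (j : N) : ℝ≥0∞ :=
  ∑' e : {e : E // M.i e = j}, M.supProb e.1

/-- Existence of a dominating Markov chain. -/
def HasDominatingChain (M : MarkovSystem K E N) : Prop := ∀ j, M.xi j < ∞

/-- The transition probabilities `q_{jk}` of the dominating Markov chain. -/
def q (M : MarkovSystem K E N) (j k : N) : ℝ≥0∞ :=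
  (M.xi j)⁻¹ * ∑' e : {e : E // M.i e = j ∧ M.t e = k}, M.supProb e.1

/-- The constant `c = ∑_k sup_j ξ_j q_{jk}`. -/
def c (M : MarkovSystem K E N) : ℝ≥0∞ := ∑' k, ⨆ j, M.xi j * M.q j k

/-- Initial vertex, extended to `∞`. -/
def iExt (M : MarkovSystem K E N) (e : ExtAlphabet E) : N := OnePoint.elim e M.base M.i

/-- Terminal vertex, extended to `∞`. -/
def tExt (M : MarkovSystem K E N) (e : ExtAlphabet E) : N := OnePoint.elim e M.base M.t

/-- The maps, extended by the identity at `∞`. -/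
def wExt (M : MarkovSystem K E N) (e : ExtAlphabet E) : K → K := OnePoint.elim e id M.w

/-- The path space `Σ_G`. -/
def pathSpace (M : MarkovSystem K E N) : Set (CodeSpace E) :=
  {σ | ∀ n : ℤ, (∃ e : E, σ n = (e : OnePoint E)) ∧ M.iExt (σ (n + 1)) = M.tExt (σ n)}

/-- `w_{σ_0} ∘ w_{σ_{-1}} ∘ ⋯ ∘ w_{σ_{-n}}`. -/
def backComp (M : MarkovSystem K E N) (σ : CodeSpace E) : ℕ → K → K
  | 0 => M.wExt (σ 0)
  | n + 1 => backComp M σ n ∘ M.wExt (σ (-((n : ℤ) + 1)))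

/-- `X_{-n}(σ) = w_{σ_0} ∘ ⋯ ∘ w_{σ_{-n}} (x_{i(σ_{-n})})`. -/
def X (M : MarkovSystem K E N) (pt : N → K) (n : ℕ) (σ : CodeSpace E) : K :=
  M.backComp σ n (pt (M.iExt (σ (-(n : ℤ)))))

/-- The set `D` of admissible codes along which the backward compositions converge. -/
def D (M : MarkovSystem K E N) (pt : N → K) : Set (CodeSpace E) :=
  {σ | σ ∈ M.pathSpace ∧ ∃ y, Tendsto (fun n => M.X pt n σ) atTop (𝓝 y)}

open Classical in
/-- The coding map `F`. -/
def F (M : MarkovSystem K E N) (pt : N → K) (σ : CodeSpace E) : K :=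
  if h : σ ∈ M.D pt then h.2.choose else pt (M.tExt (σ 0))

/-- `T_j`, the admissible codes whose zeroth edge ends at `j`. -/
def T (M : MarkovSystem K E N) (j : N) : Set (CodeSpace E) :=
  {σ | σ ∈ M.pathSpace ∧ M.tExt (σ 0) = j}

open Classical in
/-- The continuous extension of `pₑ|K_{i(e)}` to the closure of `K_{i(e)}`, extended by zero. -/
def pBar (M : MarkovSystem K E N) (e : E) (x : K) : ℝ :=
  if x ∈ closure (M.part (M.i e)) then extendFrom (M.part (M.i e)) (M.p e) x else 0

/-- The set `Ẽ(M)` of asymptotic states: shift invariant probability measures `Λ` on the code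
space with `Λ(D) = 1` and `E_Λ(1_{σ_1 = e} | past) = p̄ₑ ∘ F · 1_{T_{i(e)}}` a.e. for all `e`. -/
def asymptoticStates (M : MarkovSystem K E N) (pt : N → K) : Set (Measure (CodeSpace E)) :=
  {Λ | IsProbabilityMeasure Λ ∧ MeasurePreserving shift Λ Λ ∧ Λ (M.D pt) = 1 ∧
    ∀ e : E,
      Λ[({σ : CodeSpace E | σ 1 = (e : OnePoint E)}).indicator (fun _ => (1 : ℝ)) | past E]
        =ᵐ[Λ] (M.T (M.i e)).indicator (fun σ => M.pBar e (M.F pt σ))}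

/-- Consistency of a uniformly continuous Markov system: the image under the coding map of every
asymptotic state is an invariant measure. -/
def Consistent (M : MarkovSystem K E N) (pt : N → K) : Prop :=
  ∀ Λ ∈ M.asymptoticStates pt, Λ.map (M.F pt) ∈ M.invariantMeasures

end MarkovSystem

end RandomMarkov

end

/-! Run the random walk from `pt M.base` and record the edges it uses; before time zero the record
is filled with `∞`, a loop at the base vertex acting as the identity. Two estimates hold uniformly
in time. Since `c < ∞`, the walk stays, up to small probability, in finitely many vertex sets; since
every `ξ_j` is finite, the next edge then stays in a finite set (`exists_finset_coord_le`).
Contraction on average together with `b < ∞` bounds the mean distance from the position to the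
reference point of its vertex by `C = b / (1 - a)`, hence the mean distance from the position to the
point `X n` rebuilt from the last `n + 1` edges by `a ^ n * C` (`lintegral_edist_X_le`).

Compactness is needed for the edges only, never for positions in `K`. By Prokhorov's theorem the
time averages of the laws of the edge sequence have a limit `Λ`, tested on functions of finitely
many edges (`exists_isWindowLimit`). Averaging makes `Λ` shift invariant, as in the
Krylov–Bogoliubov argument. Under `Λ`, `X n` and `X (n + 1)` have mean distance at most `2 * C * a ^
n`, so `X n` converges a.e. and `Λ` is carried by `D` (`ae_mem_D`).

The walk chooses the edge `e` with probability `p e` at its position. Replacing the position by `X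
n` costs at most `ε + B * a ^ n * C` on average, by uniform continuity of `p e`. Letting time, then
`n`, tend to infinity and `ε` to zero gives the conditional law required of an asymptotic state
(`condExp_eq`). Consistency enters only at the very end: it sends `Λ` to an invariant measure on
`K`. -/

noncomputable section

namespace RandomMarkov

universe u v w

/-! ### Functions of finitely many coordinates, and compactness for laws of sequences -/

section Windows

variable {A : Type*} [Countable A] [MeasurableSpace A] [DiscreteMeasurableSpace A]

/-- A function of a parameter and of finitely many coordinates in a countable alphabet is
measurable as soon as it is measurable in the parameter. -/
theorem measurable_of_dependsOn {X Y Z : Type*} [MeasurableSpace X] [MeasurableSpace Y]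
    [MeasurableSpace Z] {I : Finset ℤ} {f : X → (ℤ → A) → Y}
    (hm : ∀ σ, Measurable fun x => f x σ) (hd : ∀ x, DependsOn (f x) (I : Set ℤ))
    {u : Z → X} (hu : Measurable u) {s : Z → ℤ → A}
    (hs : ∀ j ∈ I, Measurable fun z => s z j) : Measurable fun z => f (u z) (s z) := by
  rcases isEmpty_or_nonempty Z with hZ | ⟨⟨z₀⟩⟩
  · exact measurable_of_empty _
  let ext : (I → A) → ℤ → A := fun τ j => if h : j ∈ I then τ ⟨j, h⟩ else s z₀ j
  have key : (fun z => f (u z) (s z)) =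
      (fun q : X × (I → A) => f q.1 (ext q.2)) ∘ fun z => (u z, fun i : I => s z i) := by
    funext z
    refine hd _ fun j hj => ?_
    have hj' : j ∈ I := hj
    simp [ext, hj']
  rw [key]
  refine (measurable_from_prod_countable_left fun τ => hm (ext τ)).comp (hu.prodMk ?_)
  exact measurable_pi_lambda _ fun i => hs i i.2

theorem _root_.DependsOn.measurable_of_countable {Y : Type*} [MeasurableSpace Y] {I : Finset ℤ}
    {f : (ℤ → A) → Y} (hf : DependsOn f (I : Set ℤ)) : Measurable f :=
  measurable_of_dependsOn (X := Unit) (f := fun _ => f) (fun _ => measurable_const) (fun _ => hf)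
    (u := fun _ => ()) measurable_const (s := id) fun j _ => measurable_pi_apply j

theorem _root_.DependsOn.continuous_of_discrete {B Y : Type*} [TopologicalSpace B] [DiscreteTopology B]
    [TopologicalSpace Y] {I : Finset ℤ} {f : (ℤ → B) → Y} (hf : DependsOn f (I : Set ℤ)) :
    Continuous f := by
  rcases isEmpty_or_nonempty (ℤ → B) with hZ | ⟨⟨z₀⟩⟩
  · exact continuous_of_discreteTopology
  let ext : (I → B) → ℤ → B := fun τ j => if h : j ∈ I then τ ⟨j, h⟩ else z₀ j
  have key : f = (fun τ => f (ext τ)) ∘ fun σ => fun i : I => σ i := by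
    funext z
    refine hf fun j hj => ?_
    have hj' : j ∈ I := hj
    simp [ext, hj']
  rw [key]
  exact (continuous_of_discreteTopology (α := I → B)).comp (by fun_prop)

/-- Measures on a product of countable alphabets over `ℤ` all of whose coordinates are
uniformly tight have a cluster point for the convergence of window functions. -/
theorem exists_window_limit (μ : ℕ → Measure (ℤ → A)) [∀ n, IsProbabilityMeasure (μ n)]
    (tight : ∀ j : ℤ, ∀ ε : ℝ≥0∞, 0 < ε → ∃ S : Finset A, ∀ n, μ n {σ | σ j ∉ S} ≤ ε) :
    ∃ L : Filter ℕ, L.NeBot ∧ L ≤ atTop ∧ ∃ Λ : Measure (ℤ → A), IsProbabilityMeasure Λ ∧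
      ∀ (f : (ℤ → A) → ℝ≥0∞) (I : Finset ℤ) (C : ℝ≥0), DependsOn f (I : Set ℤ) →
        (∀ σ, f σ ≤ C) → Tendsto (fun n => ∫⁻ σ, f σ ∂μ n) L (𝓝 (∫⁻ σ, f σ ∂Λ)) := by
  -- With the discrete topology on the alphabet every function of finitely many coordinates is
  -- continuous. For the alphabet `OnePoint E` this also isolates `∞`, so no mass can escape to it
  -- in the limit.
  let _ : TopologicalSpace A := ⊥
  have _ : DiscreteTopology A := ⟨rfl⟩
  have _ : BorelSpace A := ⟨by
    rw [borel_eq_top_of_discrete]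
    exact eq_top_iff.2 fun s _ => MeasurableSet.of_discrete⟩
  let ν : ℕ → ProbabilityMeasure (ℤ → A) := fun n => ⟨μ n, inferInstance⟩
  have hT : IsTightMeasureSet
      {((ρ : ProbabilityMeasure (ℤ → A)) : Measure (ℤ → A)) | ρ ∈ range ν} := by
    rw [isTightMeasureSet_iff_exists_isCompact_measure_compl_le]
    intro ε hε
    -- A product of finite sets is compact; the losses in the individual coordinates are chosen
    -- summable over `ℤ`.
    obtain ⟨δ, hδ, hδs⟩ := ENNReal.exists_pos_sum_of_countable' hε.ne' ℤ
    choose S hS using fun j => tight j (δ j) (hδ j)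
    refine ⟨Set.univ.pi fun j => (S j : Set A),
      isCompact_univ_pi fun j => (S j).finite_toSet.isCompact, ?_⟩
    rintro _ ⟨_, ⟨n, rfl⟩, rfl⟩
    have hsub : (Set.univ.pi fun j => (S j : Set A))ᶜ ⊆ ⋃ j, {σ : ℤ → A | σ j ∉ S j} := by
      intro σ hσ
      simpa [Set.mem_pi] using hσ
    calc μ n (Set.univ.pi fun j => (S j : Set A))ᶜ
        ≤ ∑' j, μ n {σ : ℤ → A | σ j ∉ S j} := (measure_mono hsub).trans (measure_iUnion_le _)
      _ ≤ ∑' j, δ j := ENNReal.tsum_le_tsum fun j => hS j n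
      _ ≤ ε := hδs.le
  -- Along an ultrafilter finer than `atTop` a cluster point is a limit, so no subsequence has to be
  -- extracted.
  obtain ⟨Λ, -, hΛ⟩ := (isCompact_closure_of_isTightMeasureSet hT)
    (f := map ν (Ultrafilter.of atTop : Ultrafilter ℕ))
    (le_principal_iff.2 (mem_map.2 (univ_mem' fun n => subset_closure ⟨n, rfl⟩)))
  have hlim : Tendsto ν (Ultrafilter.of atTop : Ultrafilter ℕ) (𝓝 Λ) :=
    (Ultrafilter.map ν (Ultrafilter.of atTop)).clusterPt_iff.1 hΛ
  refine ⟨(Ultrafilter.of atTop : Ultrafilter ℕ), inferInstance, Ultrafilter.of_le _,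
    (Λ : Measure (ℤ → A)), inferInstance, fun f I C hf hfC => ?_⟩
  let g : BoundedContinuousFunction (ℤ → A) ℝ≥0 :=
    BoundedContinuousFunction.mkOfBound
      ⟨fun σ => (f σ).toNNReal, DependsOn.continuous_of_discrete (I := I) fun x y h => by
        rw [hf h]⟩ C (fun σ τ => by
        have h1 : (f σ).toNNReal ≤ C := ENNReal.toNNReal_mono ENNReal.coe_ne_top (hfC σ)
        have h2 : (f τ).toNNReal ≤ C := ENNReal.toNNReal_mono ENNReal.coe_ne_top (hfC τ)
        have h1' : ((f σ).toNNReal : ℝ) ≤ C := h1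
        have h2' : ((f τ).toNNReal : ℝ) ≤ C := h2
        have h3 : (0 : ℝ) ≤ (f σ).toNNReal := NNReal.coe_nonneg _
        have h4 : (0 : ℝ) ≤ (f τ).toNNReal := NNReal.coe_nonneg _
        rw [NNReal.dist_eq, abs_le]
        exact ⟨by simp only [ContinuousMap.coe_mk]; linarith,
          by simp only [ContinuousMap.coe_mk]; linarith⟩)
  have hfg : ∀ σ, (g σ : ℝ≥0∞) = f σ := fun σ =>
    ENNReal.coe_toNNReal (ne_top_of_le_ne_top ENNReal.coe_ne_top (hfC σ))
  have := ProbabilityMeasure.tendsto_iff_forall_lintegral_tendsto.1 hlim g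
  simp only [hfg] at this
  exact this

end Windows

/-! ### Histories of edges -/

instance {E : Type v} : DiscreteMeasurableSpace (OnePoint E) := ⟨fun _ => trivial⟩

instance {E : Type v} [Countable E] : Countable (OnePoint E) := inferInstanceAs (Countable (Option E))

/-- Append the edge `e` to a history `σ` and recentre it at the new edge. -/
def snoc {E : Type v} (σ : CodeSpace E) (e : E) : CodeSpace E :=
  fun j => if j = 0 then (e : OnePoint E) else σ (j + 1)

@[simp] theorem snoc_zero {E : Type v} (σ : CodeSpace E) (e : E) : snoc σ e 0 = e := if_pos rfl

theorem snoc_of_ne {E : Type v} (σ : CodeSpace E) (e : E) {j : ℤ} (hj : j ≠ 0) :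
    snoc σ e j = σ (j + 1) := if_neg hj

theorem measurable_snoc {E : Type v} (e : E) : Measurable fun σ : CodeSpace E => snoc σ e := by
  refine measurable_pi_lambda _ fun j => ?_
  unfold snoc
  split_ifs
  · exact measurable_const
  · exact measurable_pi_apply _

namespace MarkovSystem

variable {K : Type u} [MetricSpace K] [MeasurableSpace K] {E : Type v} {N : Type w}
  (M : MarkovSystem K E N)

theorem exists_mem_part (x : K) : ∃ j, x ∈ M.part j := by
  have : x ∈ ⋃ j, M.part j := M.part_cover ▸ mem_univ x
  simpa using this

variable {M} in
theorem eq_of_mem_part {x : K} {j k : N} (hj : x ∈ M.part j) (hk : x ∈ M.part k) : j = k := by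
  by_contra h
  exact Set.disjoint_left.1 (M.part_disjoint j k h) hj hk

variable {M} in
theorem tsum_eq_tsum_subtype {x : K} {j : N} (hx : x ∈ M.part j) (g : E → ℝ≥0∞) :
    ∑' e, ENNReal.ofReal (M.p e x) * g e =
      ∑' e : {e : E // M.i e = j}, ENNReal.ofReal (M.p e.1 x) * g e.1 := by
  refine (tsum_subtype_eq_of_support_subset (s := {e : E | M.i e = j}) fun e he => ?_).symm
  by_contra h
  refine he ?_
  have : M.p e x = 0 := M.p_eq_zero e x fun h' => h (eq_of_mem_part h' hx)
  simp [this]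

theorem tsum_ofReal_p (x : K) : ∑' e, ENNReal.ofReal (M.p e x) = 1 := by
  obtain ⟨j, hj⟩ := M.exists_mem_part x
  have h := tsum_eq_tsum_subtype hj fun _ => 1
  simp only [mul_one] at h
  rw [h, ← ENNReal.ofReal_tsum_of_nonneg (fun e => M.p_nonneg _ _) (M.p_sum j x hj).summable,
    (M.p_sum j x hj).tsum_eq, ENNReal.ofReal_one]

/-! ### Backward compositions -/

@[simp] theorem iExt_coe (e : E) : M.iExt (e : OnePoint E) = M.i e := rfl
@[simp] theorem tExt_coe (e : E) : M.tExt (e : OnePoint E) = M.t e := rfl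
@[simp] theorem wExt_coe (e : E) : M.wExt (e : OnePoint E) = M.w e := rfl
@[simp] theorem iExt_infty : M.iExt OnePoint.infty = M.base := rfl
@[simp] theorem tExt_infty : M.tExt OnePoint.infty = M.base := rfl
@[simp] theorem wExt_infty : M.wExt OnePoint.infty = id := rfl

theorem wExt_mapsTo (e : OnePoint E) :
    MapsTo (M.wExt e) (M.part (M.iExt e)) (M.part (M.tExt e)) := by
  induction e using OnePoint.rec with
  | infty => exact mapsTo_id _
  | coe e => exact M.w_mapsTo e

/-- The past of `σ` is a path, where `∞` is regarded as a loop at the base vertex. -/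
def PastPath (σ : CodeSpace E) : Prop := ∀ j : ℤ, j < 0 → M.iExt (σ (j + 1)) = M.tExt (σ j)

variable {M} in
theorem PastPath.backComp_mapsTo {σ : CodeSpace E} (h : M.PastPath σ) (n : ℕ) :
    MapsTo (M.backComp σ n) (M.part (M.iExt (σ (-(n : ℤ))))) (M.part (M.tExt (σ 0))) := by
  induction n with
  | zero => simpa [backComp] using M.wExt_mapsTo (σ 0)
  | succ n ih =>
    have h1 := h (-((n : ℤ) + 1)) (by omega)
    rw [show -((n : ℤ) + 1) + 1 = -(n : ℤ) by ring] at h1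
    rw [backComp, Nat.cast_succ]
    refine ih.comp ?_
    rw [h1]
    exact M.wExt_mapsTo _

variable {M} in
theorem PastPath.X_mem {σ : CodeSpace E} (h : M.PastPath σ) {pt : N → K}
    (hpt : ∀ j, pt j ∈ M.part j) (n : ℕ) : M.X pt n σ ∈ M.part (M.tExt (σ 0)) :=
  h.backComp_mapsTo n (hpt _)

theorem backComp_snoc (σ : CodeSpace E) (e : E) (n : ℕ) :
    M.backComp (snoc σ e) (n + 1) = M.w e ∘ M.backComp σ n := by
  induction n with
  | zero =>
    simp only [backComp, snoc_zero, wExt_coe, Nat.cast_zero]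
    rw [snoc_of_ne _ _ (by omega)]
    rfl
  | succ n ih =>
    rw [backComp, ih, backComp, snoc_of_ne _ _ (by omega), Function.comp_assoc]
    congr 4

theorem X_zero_snoc (pt : N → K) (σ : CodeSpace E) (e : E) :
    M.X pt 0 (snoc σ e) = M.w e (pt (M.i e)) := by
  simp [X, backComp]

theorem X_succ_snoc (pt : N → K) (σ : CodeSpace E) (e : E) (n : ℕ) :
    M.X pt (n + 1) (snoc σ e) = M.w e (M.X pt n σ) := by
  rw [X, backComp_snoc, snoc_of_ne _ _ (by omega)]
  simp only [X, Function.comp]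
  congr 4
  push_cast
  ring_nf

theorem backComp_congr {σ τ : CodeSpace E} {n : ℕ}
    (h : ∀ j : ℤ, -(n : ℤ) ≤ j → j ≤ 0 → σ j = τ j) : M.backComp σ n = M.backComp τ n := by
  induction n with
  | zero => rw [backComp, backComp, h 0 (by simp) le_rfl]
  | succ n ih =>
    rw [backComp, backComp, ih fun j hj => h j (by push_cast; omega),
      h _ (by push_cast; omega) (by omega)]

theorem dependsOn_X (pt : N → K) (n : ℕ) :
    DependsOn (M.X pt n) (Finset.Icc (-(n : ℤ)) 0 : Finset ℤ) := by
  intro σ τ h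
  have h' : ∀ j : ℤ, -(n : ℤ) ≤ j → j ≤ 0 → σ j = τ j := fun j h1 h2 => h j (by simp [h1, h2])
  rw [X, X, M.backComp_congr h', h' _ le_rfl (by omega)]

theorem X_infty (pt : N → K) (n : ℕ) :
    M.X pt n (fun _ => OnePoint.infty) = pt M.base := by
  have : M.backComp (fun _ => OnePoint.infty) n = id := by
    induction n with
    | zero => rfl
    | succ n ih => rw [backComp, ih]; rfl
  rw [X, this]
  rfl

/-! ### The chain of positions and histories -/

/-- One step of the random walk, acting on laws of pairs (position, history). -/
def step (ν : Measure (K × CodeSpace E)) : Measure (K × CodeSpace E) :=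
  Measure.sum fun e : E => (ν.withDensity fun z => ENNReal.ofReal (M.p e z.1)).map
    fun z => (M.w e z.1, snoc z.2 e)

theorem measurable_move (e : E) :
    Measurable fun z : K × CodeSpace E => (M.w e z.1, snoc z.2 e) :=
  ((M.w_measurable e).comp measurable_fst).prodMk ((measurable_snoc e).comp measurable_snd)

theorem measurable_weight (e : E) :
    Measurable fun z : K × CodeSpace E => ENNReal.ofReal (M.p e z.1) :=
  ((M.p_measurable e).comp measurable_fst).ennreal_ofReal

theorem lintegral_step [Countable E] (ν : Measure (K × CodeSpace E)) {f : K × CodeSpace E → ℝ≥0∞}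
    (hf : Measurable f) :
    ∫⁻ z, f z ∂M.step ν =
      ∫⁻ z, ∑' e, ENNReal.ofReal (M.p e z.1) * f (M.w e z.1, snoc z.2 e) ∂ν := by
  have hmeas : ∀ e, Measurable fun z : K × CodeSpace E =>
      ENNReal.ofReal (M.p e z.1) * f (M.w e z.1, snoc z.2 e) := fun e =>
    (M.measurable_weight e).mul (hf.comp (M.measurable_move e))
  rw [step, lintegral_sum_measure, lintegral_tsum fun e => (hmeas e).aemeasurable]
  refine tsum_congr fun e => ?_
  rw [lintegral_map hf (M.measurable_move e)]
  exact lintegral_withDensity_eq_lintegral_mul _ (M.measurable_weight e)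
    (hf.comp (M.measurable_move e))

theorem ae_step {ν : Measure (K × CodeSpace E)} [Countable E] {P : K × CodeSpace E → Prop}
    (hP : MeasurableSet {z | P z})
    (h : ∀ᵐ z ∂ν, ∀ e, M.p e z.1 ≠ 0 → P (M.w e z.1, snoc z.2 e)) : ∀ᵐ z ∂M.step ν, P z := by
  refine (Measure.ae_sum_iff' hP).2 fun e => ?_
  refine (ae_map_iff (M.measurable_move e).aemeasurable hP).2 ?_
  refine (ae_withDensity_iff (M.measurable_weight e)).2 ?_
  filter_upwards [h] with z hz h0
  refine hz e fun h1 => h0 ?_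
  rw [h1, ENNReal.ofReal_zero]

/-- The law at time `n` of the walk started at the base point with history `∞`. -/
def chain (pt : N → K) : ℕ → Measure (K × CodeSpace E)
  | 0 => Measure.dirac (pt M.base, fun _ => OnePoint.infty)
  | n + 1 => M.step (chain pt n)

instance isProbabilityMeasure_chain [Countable E] (pt : N → K) (n : ℕ) :
    IsProbabilityMeasure (M.chain pt n) := by
  induction n with
  | zero => exact Measure.dirac.isProbabilityMeasure
  | succ n ih =>
    constructor
    have := M.lintegral_step (M.chain pt n) (f := fun _ => 1) measurable_const
    simp only [lintegral_one, mul_one, tsum_ofReal_p, measure_univ] at this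
    exact this

/-- The position lies in the vertex set where the history ends, and the history is a path. -/
def Compatible (z : K × CodeSpace E) : Prop := z.1 ∈ M.part (M.tExt (z.2 0)) ∧ M.PastPath z.2

theorem measurableSet_compatible [Countable E] : MeasurableSet {z | M.Compatible z} := by
  have h1 : Measurable fun z : K × CodeSpace E => z.1 ∈ M.part (M.tExt (z.2 0)) :=
    measurable_of_dependsOn (I := {0}) (f := fun x (σ : CodeSpace E) => x ∈ M.part (M.tExt (σ 0)))
      (fun σ => measurableSet_setOfPred.1 (M.part_measurable _))
      (fun x σ τ h => by beta_reduce; rw [h 0 (by simp)])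
      measurable_fst (s := Prod.snd) fun j _ => (measurable_pi_apply j).comp measurable_snd
  have h2 : ∀ j : ℤ, Measurable fun z : K × CodeSpace E =>
      (j < 0 → M.iExt (z.2 (j + 1)) = M.tExt (z.2 j)) := fun j =>
    measurable_of_dependsOn (I := {j, j + 1})
      (f := fun (_ : K) (σ : CodeSpace E) => (j < 0 → M.iExt (σ (j + 1)) = M.tExt (σ j)))
      (fun σ => measurable_const)
      (fun x σ τ h => by beta_reduce; rw [h j (by simp), h (j + 1) (by simp)])
      measurable_fst (s := Prod.snd) fun j _ => (measurable_pi_apply j).comp measurable_snd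
  exact measurableSet_setOfPred.2 (h1.and (Measurable.forall h2))

/-- An edge has positive probability only on the vertex set it leaves, which is the one where the
history ends. The initial all-`∞` history qualifies because `∞` is a loop at `M.base`. -/
theorem ae_compatible [Countable E] {pt : N → K} (hpt : ∀ j, pt j ∈ M.part j) (n : ℕ) :
    ∀ᵐ z ∂M.chain pt n, M.Compatible z := by
  induction n with
  | zero =>
    refine (ae_dirac_iff M.measurableSet_compatible).2 ⟨hpt _, fun j _ => rfl⟩
  | succ n ih =>
    refine M.ae_step M.measurableSet_compatible ?_
    filter_upwards [ih] with z hz e he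
    have hi : z.1 ∈ M.part (M.i e) := by
      by_contra h
      exact he (M.p_eq_zero e _ h)
    refine ⟨by simpa using M.w_mapsTo e hi, fun j hj => ?_⟩
    change M.iExt (snoc z.2 e (j + 1)) = M.tExt (snoc z.2 e j)
    rw [snoc_of_ne _ _ hj.ne]
    rcases eq_or_ne j (-1) with rfl | h
    · simpa using eq_of_mem_part hi hz.1
    · rw [snoc_of_ne _ _ (by omega)]
      exact hz.2 (j + 1) (by omega)

theorem ae_ne_infty [Countable E] (pt : N → K) (n : ℕ) (j : ℤ) (hj : j ≤ 0) (hn : -(n : ℤ) < j) :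
    ∀ᵐ z ∂M.chain pt n, z.2 j ≠ OnePoint.infty := by
  induction n generalizing j with
  | zero => exact absurd hn (by simpa using hj)
  | succ n ih =>
    refine M.ae_step ?_ ?_
    · have hj' : Measurable fun z : K × CodeSpace E => z.2 j :=
        (measurable_pi_apply j).comp measurable_snd
      exact measurableSet_setOfPred.2
        ((measurable_of_countable fun a : OnePoint E => a ≠ OnePoint.infty).comp hj')
    · rcases eq_or_ne j 0 with rfl | h
      · exact ae_of_all _ fun z e _ => by simp
      · filter_upwards [ih (j + 1) (by omega) (by push_cast at hn; omega)] with z hz e _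
        change snoc z.2 e j ≠ _
        rwa [snoc_of_ne _ _ h]

/-! ### Distance between the position and its approximation by the recent history -/

theorem measurable_edist_window [Countable E] [BorelSpace K] {G : CodeSpace E → K} {I : Finset ℤ}
    (hG : DependsOn G (I : Set ℤ)) :
    Measurable fun z : K × CodeSpace E => edist z.1 (G z.2) :=
  measurable_of_dependsOn (I := I) (f := fun x (σ : CodeSpace E) => edist x (G σ))
      (fun σ => measurable_edist_left.comp measurable_id)
      (fun x σ τ h => by beta_reduce; rw [hG h])
      measurable_fst (s := Prod.snd) fun j _ => (measurable_pi_apply j).comp measurable_snd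

variable {M} in
-- The mean distance is zero at time zero, and each step maps a bound `r` to `a * r + b`; any `C`
-- with `a * C + b ≤ C` is therefore preserved.
theorem lintegral_edist_le [Countable E] [BorelSpace K] {pt : N → K} (hpt : ∀ j, pt j ∈ M.part j)
    {a C : ℝ≥0∞}
    (ha : ∀ j, ∀ x ∈ M.part j, ∀ y ∈ M.part j,
      ∑' e, ENNReal.ofReal (M.p e x) * edist (M.w e x) (M.w e y) ≤ a * edist x y)
    (hC : a * C + M.b pt ≤ C) (n : ℕ) :
    ∫⁻ z, edist z.1 (pt (M.tExt (z.2 0))) ∂M.chain pt n ≤ C := by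
  have hmeas : Measurable fun z : K × CodeSpace E => edist z.1 (pt (M.tExt (z.2 0))) :=
    measurable_edist_window (I := {0}) (G := fun σ : CodeSpace E => pt (M.tExt (σ 0)))
      fun σ τ h => by beta_reduce; rw [h 0 (by simp)]
  induction n with
  | zero =>
    rw [chain, lintegral_dirac' _ hmeas]
    simp
  | succ n ih =>
    rw [chain, M.lintegral_step _ hmeas]
    refine le_trans ?_ hC
    calc ∫⁻ z, ∑' e, ENNReal.ofReal (M.p e z.1) *
          edist (M.w e z.1) (pt (M.tExt (snoc z.2 e 0))) ∂M.chain pt n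
        ≤ ∫⁻ z, a * edist z.1 (pt (M.tExt (z.2 0))) + M.b pt ∂M.chain pt n := by
          refine lintegral_mono_ae ?_
          filter_upwards [M.ae_compatible hpt n] with z hz
          have hb : ∑' e, ENNReal.ofReal (M.p e z.1) *
              edist (M.w e (pt (M.i e))) (pt (M.t e)) ≤ M.b pt := by
            rw [tsum_eq_tsum_subtype hz.1]
            exact le_iSup_of_le (M.tExt (z.2 0)) (le_iSup₂_of_le z.1 hz.1 le_rfl)
          -- Triangle inequality through `M.w e (pt (M.i e))`; edges leaving other vertex sets have
          -- weight zero.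
          refine le_trans ?_ (add_le_add (ha _ _ hz.1 _ (hpt _)) hb)
          rw [← ENNReal.tsum_add]
          refine ENNReal.tsum_le_tsum fun e => ?_
          rw [← mul_add, snoc_zero, tExt_coe]
          by_cases he : z.1 ∈ M.part (M.i e)
          · rw [← eq_of_mem_part he hz.1]
            gcongr
            exact edist_triangle _ _ _
          · simp [M.p_eq_zero e _ he]
      _ = a * ∫⁻ z, edist z.1 (pt (M.tExt (z.2 0))) ∂M.chain pt n + M.b pt := by
          rw [lintegral_add_right _ measurable_const, lintegral_const_mul _ hmeas]
          simp
      _ ≤ a * C + M.b pt := by gcongr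

variable {M} in
-- Appending an edge applies the same map to the position and to the reconstructed point and
-- lengthens the window by one, so each step gains a factor `a`. The induction runs over time for
-- all window lengths at once. At time zero the distance vanishes, as the all-`∞` history
-- reconstructs the starting point exactly.
theorem lintegral_edist_X_le [Countable E] [BorelSpace K] {pt : N → K}
    (hpt : ∀ j, pt j ∈ M.part j) {a C : ℝ≥0∞}
    (ha : ∀ j, ∀ x ∈ M.part j, ∀ y ∈ M.part j,
      ∑' e, ENNReal.ofReal (M.p e x) * edist (M.w e x) (M.w e y) ≤ a * edist x y)
    (hC : a * C + M.b pt ≤ C) (k n : ℕ) :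
    ∫⁻ z, edist z.1 (M.X pt n z.2) ∂M.chain pt k ≤ a ^ n * C := by
  have hmeas : ∀ n, Measurable fun z : K × CodeSpace E => edist z.1 (M.X pt n z.2) := fun n =>
    measurable_edist_window (M.dependsOn_X pt n)
  induction k generalizing n with
  | zero =>
    rw [chain, lintegral_dirac' _ (hmeas n)]
    simp [X_infty]
  | succ k ih =>
    rw [chain, M.lintegral_step _ (hmeas n)]
    cases n with
    | zero =>
      have hmeas' : Measurable fun z : K × CodeSpace E => edist z.1 (pt (M.tExt (z.2 0))) :=
        measurable_edist_window (I := {0}) (G := fun σ : CodeSpace E => pt (M.tExt (σ 0)))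
          fun σ τ h => by beta_reduce; rw [h 0 (by simp)]
      calc _ ≤ ∫⁻ z, a * edist z.1 (pt (M.tExt (z.2 0))) ∂M.chain pt k := by
            refine lintegral_mono_ae ?_
            filter_upwards [M.ae_compatible hpt k] with z hz
            refine le_trans ?_ (ha _ _ hz.1 _ (hpt _))
            refine ENNReal.tsum_le_tsum fun e => ?_
            simp only [X_zero_snoc]
            by_cases he : z.1 ∈ M.part (M.i e)
            · rw [← eq_of_mem_part he hz.1]
            · simp [M.p_eq_zero e _ he]
        _ ≤ a * C := by
            rw [lintegral_const_mul _ hmeas']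
            gcongr
            exact lintegral_edist_le hpt ha hC k
        _ ≤ a ^ 0 * C := by
            rw [pow_zero, one_mul]
            exact le_self_add.trans hC
    | succ n =>
      calc _ ≤ ∫⁻ z, a * edist z.1 (M.X pt n z.2) ∂M.chain pt k := by
            refine lintegral_mono_ae ?_
            filter_upwards [M.ae_compatible hpt k] with z hz
            simp only [X_succ_snoc]
            exact ha _ _ hz.1 _ (hz.2.X_mem hpt n)
        _ ≤ a * (a ^ n * C) := by
            rw [lintegral_const_mul _ (hmeas n)]
            gcongr
            exact ih n
        _ = a ^ (n + 1) * C := by ring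

/-! ### Tightness of the edge process -/

theorem step_apply [Countable E] (ν : Measure (K × CodeSpace E)) {A : Set (K × CodeSpace E)}
    (hA : MeasurableSet A) :
    M.step ν A = ∫⁻ z, ∑' e, ENNReal.ofReal (M.p e z.1) *
      A.indicator 1 (M.w e z.1, snoc z.2 e) ∂ν := by
  rw [← lintegral_indicator_one hA, M.lintegral_step _ (measurable_one.indicator hA)]

variable {M} in
theorem ofReal_p_le_supProb {e : E} {x : K} (hx : x ∈ M.part (M.i e)) :
    ENNReal.ofReal (M.p e x) ≤ M.supProb e :=
  le_iSup₂_of_le (f := fun x _ => ENNReal.ofReal (M.p e x)) x hx le_rfl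

theorem tsum_supProb_le_xi (j k : N) :
    ∑' e : {e : E // M.i e = j ∧ M.t e = k}, M.supProb e.1 ≤ M.xi j :=
  ENNReal.tsum_mono_subtype M.supProb (s := {e | M.i e = j ∧ M.t e = k}) (t := {e | M.i e = j})
    fun _ h => h.1

theorem xi_mul_q_le (j k : N) : M.xi j * M.q j k ≤ M.xi j := by
  rw [q, ← mul_assoc]
  calc _ ≤ 1 * ∑' e : {e : E // M.i e = j ∧ M.t e = k}, M.supProb e.1 := by
        gcongr
        exact ENNReal.mul_inv_le_one _
    _ ≤ _ := by
        rw [one_mul]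
        exact M.tsum_supProb_le_xi j k

variable {M} in
theorem tsum_supProb_le_xi_mul_q (hdom : M.HasDominatingChain) (j k : N) :
    ∑' e : {e : E // M.i e = j ∧ M.t e = k}, M.supProb e.1 ≤ M.xi j * M.q j k := by
  -- If `ξ_j = 0`, then `q` contains the inverse of zero, but the sum is itself bounded by `ξ_j`.
  rcases eq_or_ne (M.xi j) 0 with h | h
  · exact (M.tsum_supProb_le_xi j k).trans (by simp [h])
  · rw [q, ← mul_assoc, ENNReal.mul_inv_cancel h (hdom j).ne, one_mul]

open Classical in
/-- A bound, uniform in time, for the probability that the chain is in the vertex set `v`. -/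
def vertexBound (k : N) : ℝ≥0∞ := (⨆ j, M.xi j * M.q j k) + if k = M.base then 1 else 0

theorem tsum_vertexBound_ne_top (hc : M.c < ∞) : ∑' k, M.vertexBound k ≠ ∞ := by
  classical
  unfold vertexBound
  rw [ENNReal.tsum_add, tsum_ite_eq M.base fun _ => (1 : ℝ≥0∞)]
  exact ENNReal.add_ne_top.2 ⟨hc.ne, ENNReal.one_ne_top⟩

variable {M} in
-- From any point of `K_j` the next step reaches `K_k` with probability at most `ξ_j * q j k`,
-- whatever the law of the current position. The extra unit at the base vertex in `vertexBound` pays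
-- for time zero.
theorem chain_part_le [Countable E] (hdom : M.HasDominatingChain) {pt : N → K}
    (hpt : ∀ j, pt j ∈ M.part j) (n : ℕ) (k : N) :
    M.chain pt n {z | z.1 ∈ M.part k} ≤ M.vertexBound k := by
  have hA : MeasurableSet {z : K × CodeSpace E | z.1 ∈ M.part k} :=
    measurable_fst (M.part_measurable k)
  cases n with
  | zero =>
    rw [chain, Measure.dirac_apply' _ hA]
    by_cases h : pt M.base ∈ M.part k
    · rw [vertexBound, if_pos (eq_of_mem_part h (hpt _))]
      exact le_trans (indicator_le_self' (by simp) _) le_add_self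
    · simp [h]
  | succ n =>
    rw [chain, M.step_apply _ hA]
    refine le_trans ?_ (le_self_add : (⨆ j, M.xi j * M.q j k) ≤ _)
    calc _ ≤ ∫⁻ _, (⨆ j, M.xi j * M.q j k) ∂M.chain pt n := by
          refine lintegral_mono fun z => ?_
          obtain ⟨j, hj⟩ := M.exists_mem_part z.1
          refine le_trans ?_ ((tsum_supProb_le_xi_mul_q hdom j k).trans
            (le_iSup (fun j => M.xi j * M.q j k) j))
          refine le_trans ?_
            (tsum_subtype {e : E | M.i e = j ∧ M.t e = k} M.supProb).symm.le
          refine ENNReal.tsum_le_tsum fun e => ?_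
          by_cases he : z.1 ∈ M.part (M.i e)
          · by_cases ht : M.t e = k
            · rw [indicator_of_mem (show e ∈ {e : E | M.i e = j ∧ M.t e = k} from
                ⟨eq_of_mem_part he hj, ht⟩)]
              refine le_trans ?_ (ofReal_p_le_supProb he)
              refine mul_le_of_le_one_right' ?_
              exact indicator_le_self' (by simp) _
            · have : (M.w e z.1, snoc z.2 e) ∉ {z : K × CodeSpace E | z.1 ∈ M.part k} :=
                fun h => ht (eq_of_mem_part (M.w_mapsTo e he) h)
              simp [indicator_of_notMem this]
          · simp [M.p_eq_zero e _ he]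
      _ = _ := by simp

variable {M} in
-- Half of `ε` is spent on being outside a finite set `V` of vertices, by summability of
-- `vertexBound`. The other half goes to the tail of `supProb` over edges starting in `V`, whose sum
-- is at most the finite sum of the `ξ_v`.
theorem exists_finset_tail_le [Countable E] [Countable N] (hdom : M.HasDominatingChain)
    (hc : M.c < ∞) {pt : N → K} (hpt : ∀ j, pt j ∈ M.part j) {ε : ℝ≥0∞} (hε : 0 < ε) :
    ∃ S : Finset E, ∀ n, ∫⁻ z, ∑' e, ENNReal.ofReal (M.p e z.1) *
      ({e | e ∉ S} : Set E).indicator 1 e ∂M.chain pt n ≤ ε := by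
  classical
  have hε2 : 0 < ε / 2 := ENNReal.half_pos hε.ne'
  obtain ⟨V, hV⟩ := ((ENNReal.tendsto_tsum_compl_atTop_zero
    (M.tsum_vertexBound_ne_top hc)).eventually (ge_mem_nhds hε2)).exists
  let g : E → ℝ≥0∞ := {e | M.i e ∈ V}.indicator M.supProb
  have hg : ∑' e, g e ≠ ∞ := by
    have hle : ∑' e, g e ≤ ∑ v ∈ V, M.xi v := by
      have hxi : ∀ v, M.xi v = ∑' e, ({e | M.i e = v} : Set E).indicator M.supProb e :=
        fun v => tsum_subtype {e : E | M.i e = v} M.supProb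
      rw [Finset.sum_congr rfl fun v _ => hxi v,
        ← Summable.tsum_finsetSum fun _ _ => ENNReal.summable]
      refine ENNReal.tsum_le_tsum fun e => ?_
      by_cases he : M.i e ∈ V
      · refine le_trans ?_ (Finset.single_le_sum (fun _ _ => zero_le) he)
        simp [g, he]
      · simp [g, he]
    exact ne_top_of_le_ne_top (ENNReal.sum_lt_top.2 fun v _ => hdom v).ne hle
  obtain ⟨S, hS⟩ := ((ENNReal.tendsto_tsum_compl_atTop_zero hg).eventually
    (ge_mem_nhds hε2)).exists
  refine ⟨S, fun n => ?_⟩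
  let A : Set (K × CodeSpace E) := ⋃ v : {v // v ∉ V}, {z | z.1 ∈ M.part v}
  have hA : MeasurableSet A :=
    MeasurableSet.iUnion fun v => measurable_fst (M.part_measurable v)
  calc _ ≤ ∫⁻ z, A.indicator 1 z + ∑' e : {e // e ∉ S}, g e ∂M.chain pt n := by
        refine lintegral_mono fun z => ?_
        by_cases hz : z ∈ A
        · rw [indicator_of_mem hz]
          refine le_trans ?_ (le_self_add : (1 : ℝ≥0∞) ≤ _)
          rw [← M.tsum_ofReal_p z.1]
          refine ENNReal.tsum_le_tsum fun e => mul_le_of_le_one_right' ?_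
          exact indicator_le_self' (by simp) _
        · refine le_trans ?_ le_add_self
          refine le_trans ?_ (tsum_subtype {e : E | e ∉ S} g).symm.le
          refine ENNReal.tsum_le_tsum fun e => ?_
          by_cases he : z.1 ∈ M.part (M.i e)
          · have hi : M.i e ∈ V := by
              by_contra h
              exact hz (mem_iUnion.2 ⟨⟨_, h⟩, he⟩)
            by_cases heS : e ∈ S
            · simp [heS]
            · simpa [heS, g, hi] using ofReal_p_le_supProb he
          · simp [M.p_eq_zero e _ he]
    _ = M.chain pt n A + ∑' e : {e // e ∉ S}, g e := by
        rw [lintegral_add_right _ measurable_const, lintegral_indicator_one hA]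
        simp
    _ ≤ ε / 2 + ε / 2 := by
        refine add_le_add (((measure_iUnion_le _).trans ?_).trans hV) hS
        exact ENNReal.tsum_le_tsum fun v => chain_part_le hdom hpt n v
    _ = ε := ENNReal.add_halves ε

variable {M} in
theorem exists_finset_coord_le [Countable E] [Countable N] (hdom : M.HasDominatingChain)
    (hc : M.c < ∞) {pt : N → K} (hpt : ∀ j, pt j ∈ M.part j) {ε : ℝ≥0∞} (hε : 0 < ε) :
    ∃ S : Finset (OnePoint E), ∀ n (j : ℤ), M.chain pt n {z | z.2 j ∉ S} ≤ ε := by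
  classical
  obtain ⟨S, hS⟩ := exists_finset_tail_le hdom hc hpt hε
  -- `∞` is included so that the initial history lies entirely in `S'`.
  let S' : Finset (OnePoint E) := insert OnePoint.infty (S.image (↑))
  have hA : ∀ j : ℤ, MeasurableSet {z : K × CodeSpace E | z.2 j ∉ S'} := fun j => by
    have hj : Measurable fun z : K × CodeSpace E => z.2 j :=
      (measurable_pi_apply j).comp measurable_snd
    exact hj (MeasurableSet.of_discrete : MeasurableSet {a : OnePoint E | a ∉ S'})
  refine ⟨S', fun n => ?_⟩
  induction n with
  | zero =>
    intro j
    rw [chain, Measure.dirac_apply' _ (hA j)]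
    simp [S']
  | succ n ih =>
    intro j
    rw [chain, M.step_apply _ (hA j)]
    rcases eq_or_ne j 0 with rfl | hj
    · refine le_trans (lintegral_mono fun z => ENNReal.tsum_le_tsum fun e => ?_) (hS n)
      gcongr
      by_cases he : e ∈ S
      · simp [S', he]
      · simp [he, S']
    -- Every coordinate other than the newest is inherited from the previous time, shifted by one.
    · refine le_trans (le_of_eq ?_) (ih (j + 1))
      rw [← lintegral_indicator_one (hA (j + 1))]
      refine lintegral_congr fun z => ?_
      have : ∀ e, ({z | z.2 j ∉ S'} : Set (K × CodeSpace E)).indicator (1 : K × CodeSpace E → ℝ≥0∞)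
          (M.w e z.1, snoc z.2 e) =
          ({z | z.2 (j + 1) ∉ S'} : Set (K × CodeSpace E)).indicator 1 z := fun e => by
        simp [indicator_apply, snoc_of_ne _ _ hj]
      simp only [this, ENNReal.tsum_mul_right, tsum_ofReal_p, one_mul]

/-! ### Laws of recentred edge sequences -/

/-- The law of the edge sequence seen from time `k`, with `s` edges of the future. -/
def law (pt : N → K) (k s : ℕ) : Measure (CodeSpace E) :=
  (M.chain pt (k + s)).map fun z j => z.2 (j - s)

theorem measurable_recentre {Y : Type*} [MeasurableSpace Y] (s : ℕ) :
    Measurable fun (z : Y × CodeSpace E) (j : ℤ) => z.2 (j - s) :=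
  measurable_pi_lambda _ fun j => (measurable_pi_apply (j - s)).comp measurable_snd

instance isProbabilityMeasure_law [Countable E] (pt : N → K) (k s : ℕ) :
    IsProbabilityMeasure (M.law pt k s) :=
  Measure.isProbabilityMeasure_map (measurable_recentre s).aemeasurable

theorem lintegral_law (pt : N → K) (k s : ℕ) {f : CodeSpace E → ℝ≥0∞} (hf : Measurable f) :
    ∫⁻ σ, f σ ∂M.law pt k s = ∫⁻ z, f (fun j => z.2 (j - s)) ∂M.chain pt (k + s) :=
  lintegral_map hf (measurable_recentre s)

theorem lintegral_law_zero (pt : N → K) (k : ℕ) {f : CodeSpace E → ℝ≥0∞} (hf : Measurable f) :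
    ∫⁻ σ, f σ ∂M.law pt k 0 = ∫⁻ z, f z.2 ∂M.chain pt k := by
  rw [M.lintegral_law pt k 0 hf]
  simp

theorem lintegral_law_succ [Countable E] (pt : N → K) (k s : ℕ) {f : CodeSpace E → ℝ≥0∞}
    (hf : Measurable f) :
    ∫⁻ σ, f σ ∂M.law pt k (s + 1) = ∫⁻ z, ∑' e, ENNReal.ofReal (M.p e z.1) *
      f (fun j => if j = s + 1 then (e : OnePoint E) else z.2 (j - s)) ∂M.chain pt (k + s) := by
  rw [M.lintegral_law pt k (s + 1) hf, ← add_assoc, chain]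
  refine (M.lintegral_step _ (hf.comp (measurable_recentre (s + 1)))).trans ?_
  refine lintegral_congr fun z => tsum_congr fun e => ?_
  rw [Function.comp_apply]
  congr 2
  funext j
  by_cases hj : j = s + 1
  · simp [hj]
  · have : j - ((s + 1 : ℕ) : ℤ) ≠ 0 := by push_cast; omega
    change snoc z.2 e _ = _
    rw [snoc_of_ne _ _ this, if_neg hj]
    refine congrArg z.2 ?_
    push_cast
    ring

theorem lintegral_law_succ_of_dependsOn [Countable E] (pt : N → K) (k s : ℕ)
    {f : CodeSpace E → ℝ≥0∞} (hf : Measurable f) (hd : DependsOn f (Iic (s : ℤ))) :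
    ∫⁻ σ, f σ ∂M.law pt k (s + 1) = ∫⁻ σ, f σ ∂M.law pt k s := by
  rw [M.lintegral_law_succ pt k s hf, M.lintegral_law pt k s hf]
  refine lintegral_congr fun z => ?_
  have : ∀ e : E, f (fun j => if j = s + 1 then (e : OnePoint E) else z.2 (j - s)) =
      f (fun j => z.2 (j - s)) := fun e => hd fun j hj => by
    have : j ≠ s + 1 := by have : j ≤ s := hj; omega
    beta_reduce
    rw [if_neg this]
  simp only [this, ENNReal.tsum_mul_right, tsum_ofReal_p, one_mul]

/-- The probabilities of the next edge sum to one, so revealing more of the future does not change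
the law of the coordinates up to `s`. Estimates with `s = 0` or `s = 1` thus carry over to the
averages, where `s = n`. -/
theorem lintegral_law_of_le [Countable E] (pt : N → K) (k : ℕ) {s s' : ℕ} (hs : s ≤ s')
    {f : CodeSpace E → ℝ≥0∞} (hf : Measurable f) (hd : DependsOn f (Iic (s : ℤ))) :
    ∫⁻ σ, f σ ∂M.law pt k s' = ∫⁻ σ, f σ ∂M.law pt k s := by
  induction s', hs using Nat.le_induction with
  | base => rfl
  | succ m hm ih =>
    rw [← ih, M.lintegral_law_succ_of_dependsOn pt k m hf
      (hd.mono (Iic_subset_Iic.2 (by exact_mod_cast hm)))]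

theorem measurable_shift : Measurable (shift : CodeSpace E → CodeSpace E) :=
  measurable_pi_lambda _ fun _ => measurable_pi_apply _

theorem lintegral_law_shift (pt : N → K) (k s : ℕ) {f : CodeSpace E → ℝ≥0∞} (hf : Measurable f) :
    ∫⁻ σ, f (shift σ) ∂M.law pt k (s + 1) = ∫⁻ σ, f σ ∂M.law pt (k + 1) s := by
  refine (M.lintegral_law pt k (s + 1) (hf.comp measurable_shift)).trans ?_
  rw [M.lintegral_law pt (k + 1) s hf, show k + 1 + s = k + (s + 1) by ring]
  refine lintegral_congr fun z => ?_
  rw [Function.comp_apply]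
  congr 1
  funext j
  refine congrArg z.2 ?_
  push_cast
  ring

/-- The time averages of the laws of the edge sequence. -/
def averagedLaw (pt : N → K) (n : ℕ) : Measure (CodeSpace E) :=
  ((n : ℝ≥0∞) + 1)⁻¹ • ∑ k ∈ Finset.range (n + 1), M.law pt (k + n) n

theorem lintegral_averagedLaw (pt : N → K) (n : ℕ) (f : CodeSpace E → ℝ≥0∞) :
    ∫⁻ σ, f σ ∂M.averagedLaw pt n =
      ((n : ℝ≥0∞) + 1)⁻¹ * ∑ k ∈ Finset.range (n + 1), ∫⁻ σ, f σ ∂M.law pt (k + n) n := by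
  rw [averagedLaw, lintegral_smul_measure, lintegral_finsetSum_measure, smul_eq_mul]

theorem inv_succ_mul_succ (n : ℕ) : ((n : ℝ≥0∞) + 1)⁻¹ * ((n : ℝ≥0∞) + 1) = 1 :=
  ENNReal.inv_mul_cancel (by simp) (by finiteness)

theorem lintegral_averagedLaw_le {pt : N → K} {n : ℕ} {f g : CodeSpace E → ℝ≥0∞} {c : ℝ≥0∞}
    (h : ∀ k, ∫⁻ σ, f σ ∂M.law pt (k + n) n ≤ ∫⁻ σ, g σ ∂M.law pt (k + n) n + c) :
    ∫⁻ σ, f σ ∂M.averagedLaw pt n ≤ ∫⁻ σ, g σ ∂M.averagedLaw pt n + c := by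
  rw [lintegral_averagedLaw, lintegral_averagedLaw]
  calc _ ≤ ((n : ℝ≥0∞) + 1)⁻¹ * ∑ k ∈ Finset.range (n + 1),
        (∫⁻ σ, g σ ∂M.law pt (k + n) n + c) := by
        gcongr with k
        exact h k
    _ = _ := by
        rw [Finset.sum_add_distrib, mul_add, Finset.sum_const, Finset.card_range, nsmul_eq_mul,
          Nat.cast_succ, ← mul_assoc _ _ c, inv_succ_mul_succ, one_mul]

instance isProbabilityMeasure_averagedLaw [Countable E] (pt : N → K) (n : ℕ) :
    IsProbabilityMeasure (M.averagedLaw pt n) := by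
  constructor
  rw [← lintegral_one, lintegral_averagedLaw]
  simp only [lintegral_one, measure_univ, Finset.sum_const, Finset.card_range, nsmul_eq_mul,
    Nat.cast_succ, mul_one, inv_succ_mul_succ]

/-- Shifting moves the present time by one, so the two averages share all but one term each; the
unmatched term has weight `1 / (n + 1)`. -/
theorem lintegral_averagedLaw_shift_le [Countable E] (pt : N → K) (n : ℕ)
    {f : CodeSpace E → ℝ≥0∞} (hf : Measurable f) (hf1 : ∀ σ, f σ ≤ 1)
    (hd : DependsOn f (Iic ((n : ℤ) - 1))) :
    ∫⁻ σ, f (shift σ) ∂M.averagedLaw pt n ≤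
      ∫⁻ σ, f σ ∂M.averagedLaw pt n + ((n : ℝ≥0∞) + 1)⁻¹ := by
  have hle : ∀ k, ∫⁻ σ, f σ ∂M.law pt k n ≤ 1 := fun k =>
    (lintegral_mono hf1).trans (by simp)
  cases n with
  | zero =>
    refine le_trans ?_ le_add_self
    refine (lintegral_mono fun σ => hf1 _).trans (by simp)
  | succ m =>
    have hd' : DependsOn f (Iic (m : ℤ)) := by simpa using hd
    have key : ∀ k, ∫⁻ σ, f (shift σ) ∂M.law pt (k + (m + 1)) (m + 1) =
        ∫⁻ σ, f σ ∂M.law pt (k + 1 + (m + 1)) (m + 1) := fun k => by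
      rw [M.lintegral_law_shift pt _ m hf, M.lintegral_law_succ_of_dependsOn pt _ m hf hd']
      congr 2
      ring
    rw [lintegral_averagedLaw, lintegral_averagedLaw]
    simp only [key]
    rw [Finset.sum_range_succ]
    conv_rhs => rw [Finset.sum_range_succ']
    rw [mul_add, mul_add]
    refine add_le_add ?_ ?_
    · exact le_self_add
    · exact mul_le_of_le_one_right' (hle _)

/-! ### Limits of the averaged laws -/

/-- `Λ` is the limit of the averaged laws along `L`, tested on functions of finitely many edges. -/
structure IsWindowLimit (pt : N → K) (L : Filter ℕ) (Λ : Measure (CodeSpace E)) : Prop where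
  neBot : L.NeBot
  le_atTop : L ≤ atTop
  isProbabilityMeasure : IsProbabilityMeasure Λ
  tendsto : ∀ (f : CodeSpace E → ℝ≥0∞) (I : Finset ℤ) (C : ℝ≥0), DependsOn f (I : Set ℤ) →
    (∀ σ, f σ ≤ C) →
    Tendsto (fun n => ∫⁻ σ, f σ ∂M.averagedLaw pt n) L (𝓝 (∫⁻ σ, f σ ∂Λ))

theorem _root_.DependsOn.indicator_one {ι A : Type*} {B : Set (ι → A)} {I : Set ι}
    (hB : DependsOn (· ∈ B) I) : DependsOn (B.indicator (1 : (ι → A) → ℝ≥0∞)) I := by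
  classical
  intro σ τ h
  have := hB h
  simp only [indicator_apply, Pi.one_apply]
  exact if_congr this.to_iff rfl rfl

variable {M} in
theorem exists_isWindowLimit [Countable E] [Countable N] (hdom : M.HasDominatingChain)
    (hc : M.c < ∞) {pt : N → K} (hpt : ∀ j, pt j ∈ M.part j) :
    ∃ L Λ, M.IsWindowLimit pt L Λ := by
  obtain ⟨L, hL, hLt, Λ, hΛ, hlim⟩ := exists_window_limit (M.averagedLaw pt) fun j ε hε => by
    obtain ⟨S, hS⟩ := exists_finset_coord_le hdom hc hpt hε
    refine ⟨S, fun n => ?_⟩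
    have hA : MeasurableSet {σ : CodeSpace E | σ j ∉ S} :=
      (measurable_pi_apply (X := fun _ : ℤ => OnePoint E) j)
        (MeasurableSet.of_discrete : MeasurableSet {a : OnePoint E | a ∉ S})
    have := M.lintegral_averagedLaw_le (pt := pt) (n := n) (c := ε) (g := 0)
      (f := ({σ : CodeSpace E | σ j ∉ S} : Set _).indicator 1) fun k => by
        rw [lintegral_indicator_one hA, law, Measure.map_apply (measurable_recentre n) hA]
        exact (hS _ _).trans le_add_self
    simpa [lintegral_indicator_one hA] using this
  exact ⟨L, Λ, hL, hLt, hΛ, hlim⟩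

namespace IsWindowLimit

variable {M} {pt : N → K} {L : Filter ℕ} {Λ : Measure (CodeSpace E)}

theorem lintegral_le (h : M.IsWindowLimit pt L Λ) {f g : CodeSpace E → ℝ≥0∞} {I J : Finset ℤ}
    {C D : ℝ≥0} {c : ℝ≥0∞} (hf : DependsOn f (I : Set ℤ)) (hg : DependsOn g (J : Set ℤ))
    (hfC : ∀ σ, f σ ≤ C) (hgD : ∀ σ, g σ ≤ D)
    (hfg : ∀ᶠ n in atTop, ∀ k, ∫⁻ σ, f σ ∂M.law pt (k + n) n ≤
      ∫⁻ σ, g σ ∂M.law pt (k + n) n + c) :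
    ∫⁻ σ, f σ ∂Λ ≤ ∫⁻ σ, g σ ∂Λ + c := by
  have := h.neBot
  refine le_of_tendsto_of_tendsto (h.tendsto f I C hf hfC)
    ((h.tendsto g J D hg hgD).add_const c) ?_
  filter_upwards [h.le_atTop hfg] with n hn
  exact M.lintegral_averagedLaw_le hn

theorem lintegral_le_of_past [Countable E] (h : M.IsWindowLimit pt L Λ)
    {f g : CodeSpace E → ℝ≥0∞} {I J : Finset ℤ} {C D : ℝ≥0} {c : ℝ≥0∞} (s : ℕ)
    (hf : DependsOn f (I : Set ℤ)) (hg : DependsOn g (J : Set ℤ))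
    (hfC : ∀ σ, f σ ≤ C) (hgD : ∀ σ, g σ ≤ D)
    (hI : (I : Set ℤ) ⊆ Iic (s : ℤ)) (hJ : (J : Set ℤ) ⊆ Iic (s : ℤ))
    (hfg : ∀ k, ∫⁻ σ, f σ ∂M.law pt k s ≤ ∫⁻ σ, g σ ∂M.law pt k s + c) :
    ∫⁻ σ, f σ ∂Λ ≤ ∫⁻ σ, g σ ∂Λ + c := by
  refine h.lintegral_le hf hg hfC hgD ?_
  filter_upwards [eventually_ge_atTop s] with n hn k
  rw [M.lintegral_law_of_le pt _ hn hf.measurable_of_countable (hf.mono hI),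
    M.lintegral_law_of_le pt _ hn hg.measurable_of_countable (hg.mono hJ)]
  exact hfg _

theorem ae_of_window [Countable E] (h : M.IsWindowLimit pt L Λ) {P : CodeSpace E → Prop}
    {I : Finset ℤ} (hP : DependsOn P (I : Set ℤ))
    (hae : ∀ᶠ n in atTop, ∀ k, ∀ᵐ z ∂M.chain pt (k + n + n), P fun j => z.2 (j - n)) :
    ∀ᵐ σ ∂Λ, P σ := by
  have hP' : DependsOn (· ∈ {σ | ¬ P σ}) (I : Set ℤ) := fun σ τ hστ => by
    change (¬ P σ) = ¬ P τ
    rw [hP hστ]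
  have hm : MeasurableSet {σ | ¬ P σ} := measurableSet_setOfPred.2 hP'.measurable_of_countable
  have hd := hP'.indicator_one
  have key := h.lintegral_le (g := 0) (J := ∅) (C := 1) (D := 0) (c := 0) hd
    (fun _ _ _ => rfl) (fun σ => indicator_le_self' (by simp) σ) (fun σ => by simp) (by
      filter_upwards [hae] with n hn k
      rw [M.lintegral_law pt (k + n) n hd.measurable_of_countable]
      refine le_trans (lintegral_mono_ae (g := 0) ?_) (by simp)
      filter_upwards [hn k] with z hz
      simp [hz])
  rw [lintegral_indicator_one hm] at key
  simpa [ae_iff] using key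

theorem ae_mem_pathSpace [Countable E] (h : M.IsWindowLimit pt L Λ)
    (hpt : ∀ j, pt j ∈ M.part j) : ∀ᵐ σ ∂Λ, σ ∈ M.pathSpace := by
  have h1 : ∀ᵐ σ ∂Λ, ∀ n : ℤ, σ n ≠ OnePoint.infty := by
    refine ae_all_iff.2 fun n => h.ae_of_window (P := fun σ => σ n ≠ OnePoint.infty) (I := {n})
      (fun σ τ hστ => by beta_reduce; rw [hστ n (by simp)]) ?_
    filter_upwards [eventually_ge_atTop (n.natAbs + 1)] with m hm k
    exact M.ae_ne_infty pt _ _ (by omega) (by omega)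
  have h2 : ∀ᵐ σ ∂Λ, ∀ n : ℤ, M.iExt (σ (n + 1)) = M.tExt (σ n) := by
    refine ae_all_iff.2 fun n => h.ae_of_window
      (P := fun σ => M.iExt (σ (n + 1)) = M.tExt (σ n)) (I := {n, n + 1})
      (fun σ τ hστ => by beta_reduce; rw [hστ n (by simp), hστ (n + 1) (by simp)]) ?_
    filter_upwards [eventually_ge_atTop (n.natAbs + 1)] with m hm k
    filter_upwards [M.ae_compatible hpt (k + m + m)] with z hz
    have := hz.2 (n - m) (by omega)
    rwa [show n - (m : ℤ) + 1 = n + 1 - m by ring] at this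
  filter_upwards [h1, h2] with σ hσ1 hσ2 n
  exact ⟨(OnePoint.ne_infty_iff_exists.1 (hσ1 n)).imp fun _ => Eq.symm, hσ2 n⟩

/-- The boundary term vanishes in the limit, giving `Λ.map shift A ≤ Λ A` for cylinders `A`.
Applying this to the complement as well forces equality, since both measures have total mass one. -/
theorem measurePreserving_shift [Countable E] (h : M.IsWindowLimit pt L Λ) :
    MeasurePreserving shift Λ Λ := by
  have := h.neBot
  have := h.isProbabilityMeasure
  have : IsProbabilityMeasure (Λ.map shift) :=
    Measure.isProbabilityMeasure_map measurable_shift.aemeasurable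
  have hle : ∀ A ∈ measurableCylinders (fun _ : ℤ => OnePoint E), Λ.map shift A ≤ Λ A := by
    intro A hA
    have hAm : MeasurableSet A := MeasurableSet.of_mem_measurableCylinders hA
    obtain ⟨I, S, -, rfl⟩ := (mem_measurableCylinders _).1 hA
    have hd' : DependsOn (fun σ : CodeSpace E => σ ∈ cylinder I S) (I : Set ℤ) := fun σ τ hστ => by
      have : I.restrict σ = I.restrict τ := funext fun i => hστ i i.2
      change (I.restrict σ ∈ S) = (I.restrict τ ∈ S)
      rw [this]
    have hd := hd'.indicator_one
    have hf1 : ∀ σ, (cylinder I S).indicator (1 : CodeSpace E → ℝ≥0∞) σ ≤ 1 := fun σ =>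
      indicator_le_self' (by simp) σ
    rw [Measure.map_apply measurable_shift hAm, ← lintegral_indicator_one hAm,
      ← lintegral_indicator_one (measurable_shift hAm)]
    change ∫⁻ σ, (cylinder I S).indicator 1 (shift σ) ∂Λ ≤ _
    have hds : DependsOn (fun σ : CodeSpace E => (cylinder I S).indicator
        (1 : CodeSpace E → ℝ≥0∞) (shift σ))
        (I.image (· + 1) : Finset ℤ) := fun σ τ hστ =>
      hd fun i hi => hστ (i + 1) (by simpa using hi)
    have h0 : Tendsto (fun n : ℕ => ((n : ℝ≥0∞) + 1)⁻¹) L (𝓝 0) := by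
      have := (tendsto_add_atTop_iff_nat 1).2 ENNReal.tendsto_inv_nat_nhds_zero
      simpa using this.mono_left h.le_atTop
    have hlim := (h.tendsto _ _ 1 hd hf1).add h0
    rw [add_zero] at hlim
    refine le_of_tendsto_of_tendsto (h.tendsto _ _ 1 hds fun σ => hf1 _) hlim ?_
    obtain ⟨b, hb⟩ := I.bddAbove
    filter_upwards [h.le_atTop (eventually_ge_atTop (b.natAbs + 1))] with n hn
    refine M.lintegral_averagedLaw_shift_le pt n hd.measurable_of_countable hf1
      (hd.mono fun i hi => ?_)
    have : i ≤ b := hb hi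
    have hn' : b.natAbs + 1 ≤ n := hn
    simp only [mem_Iic]
    omega
  refine ⟨measurable_shift, ext_of_generate_finite (measurableCylinders fun _ : ℤ => OnePoint E)
    generateFrom_measurableCylinders.symm isPiSystem_measurableCylinders (fun A hA => ?_) (by simp)⟩
  refine le_antisymm (hle A hA) ?_
  have hAm : MeasurableSet A := MeasurableSet.of_mem_measurableCylinders hA
  have h2 := hle Aᶜ (compl_mem_measurableCylinders hA)
  refine (ENNReal.add_le_add_iff_right (measure_ne_top Λ Aᶜ)).1 ?_
  calc Λ A + Λ Aᶜ = Λ.map shift A + Λ.map shift Aᶜ := by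
        rw [prob_add_prob_compl hAm, prob_add_prob_compl hAm]
    _ ≤ _ := by gcongr

/-- Under the chain both points are close in mean to the actual position. The position does not
survive in the limit but the distance between the two reconstructions does; it is truncated at `m`
to be an admissible bounded test function, and monotone convergence removes the truncation. -/
theorem lintegral_edist_X_succ_le [Countable E] [BorelSpace K] (h : M.IsWindowLimit pt L Λ)
    {a C : ℝ≥0∞} (ha : a ≤ 1)
    (hX : ∀ k n, ∫⁻ z, edist z.1 (M.X pt n z.2) ∂M.chain pt k ≤ a ^ n * C) (n : ℕ) :
    ∫⁻ σ, edist (M.X pt n σ) (M.X pt (n + 1) σ) ∂Λ ≤ a ^ n * (C + C) := by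
  let I : Finset ℤ := Finset.Icc (-((n + 1 : ℕ) : ℤ)) 0
  have hd : DependsOn (fun σ => edist (M.X pt n σ) (M.X pt (n + 1) σ)) (I : Set ℤ) := by
    intro σ τ hστ
    beta_reduce
    rw [M.dependsOn_X pt (n + 1) hστ, M.dependsOn_X pt n fun i hi => hστ i ?_]
    simp only [Finset.coe_Icc, mem_Icc, I] at hi ⊢
    push_cast
    omega
  have hsup : ∀ x : ℝ≥0∞, x = ⨆ m : ℕ, min x m := fun x => by
    rw [← inf_iSup_eq, ENNReal.iSup_natCast, inf_top_eq]
  have hm : ∀ m : ℕ, DependsOn (fun σ => min (edist (M.X pt n σ) (M.X pt (n + 1) σ)) (m : ℝ≥0∞))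
      (I : Set ℤ) := fun m σ τ hστ => congrArg (min · (m : ℝ≥0∞)) (hd hστ)
  have hI : (I : Set ℤ) ⊆ Iic ((0 : ℕ) : ℤ) := fun i hi => by
    simp only [Finset.coe_Icc, mem_Icc, I] at hi
    simpa using hi.2
  calc _ = ∫⁻ σ, ⨆ m : ℕ, min (edist (M.X pt n σ) (M.X pt (n + 1) σ)) (m : ℝ≥0∞) ∂Λ :=
        lintegral_congr fun σ => hsup _
    _ = ⨆ m : ℕ, ∫⁻ σ, min (edist (M.X pt n σ) (M.X pt (n + 1) σ)) (m : ℝ≥0∞) ∂Λ := by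
        refine lintegral_iSup (fun m => (hm m).measurable_of_countable) fun i j hij σ => ?_
        exact min_le_min_left _ (by exact_mod_cast hij)
    _ ≤ _ := by
        refine iSup_le fun m => ?_
        have key := h.lintegral_le_of_past (g := 0) (J := ∅) (C := m) (D := 0)
          (c := a ^ n * (C + C)) 0 (hm m) (fun _ _ _ => rfl) (fun σ => by simp)
          (fun σ => by simp) hI (by simp) fun k => by
            rw [M.lintegral_law_zero pt k (hm m).measurable_of_countable]
            calc _ ≤ ∫⁻ z, edist z.1 (M.X pt n z.2) + edist z.1 (M.X pt (n + 1) z.2)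
                  ∂M.chain pt k := by
                  refine lintegral_mono fun z => (min_le_left _ _).trans ?_
                  exact edist_triangle_left _ _ _
              _ ≤ a ^ n * C + a ^ (n + 1) * C := by
                  rw [lintegral_add_left (measurable_edist_window (M.dependsOn_X pt n))]
                  exact add_le_add (hX k n) (hX k (n + 1))
              _ ≤ a ^ n * C + a ^ n * C := by
                  have : a ^ (n + 1) ≤ a ^ n := pow_le_pow_right_of_le_one' ha (Nat.le_succ n)
                  gcongr
              _ = a ^ n * (C + C) := by ring
              _ ≤ _ := le_add_self
        simpa using key

theorem ae_mem_D [Countable E] [BorelSpace K] [CompleteSpace K] (h : M.IsWindowLimit pt L Λ)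
    (hpt : ∀ j, pt j ∈ M.part j) {a C : ℝ≥0∞} (ha : a < 1) (hC : C ≠ ∞)
    (hX : ∀ k n, ∫⁻ z, edist z.1 (M.X pt n z.2) ∂M.chain pt k ≤ a ^ n * C) :
    ∀ᵐ σ ∂Λ, σ ∈ M.D pt := by
  have hmeas : ∀ n, Measurable fun σ => edist (M.X pt n σ) (M.X pt (n + 1) σ) := fun n =>
    DependsOn.measurable_of_countable (I := Finset.Icc (-((n + 1 : ℕ) : ℤ)) 0) fun σ τ hστ => by
      rw [M.dependsOn_X pt (n + 1) hστ, M.dependsOn_X pt n fun i hi => hστ i ?_]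
      simp only [Finset.coe_Icc, mem_Icc] at hi ⊢
      push_cast
      omega
  have hfin : ∫⁻ σ, ∑' n, edist (M.X pt n σ) (M.X pt (n + 1) σ) ∂Λ ≠ ∞ := by
    rw [lintegral_tsum fun n => (hmeas n).aemeasurable]
    refine ne_top_of_le_ne_top ?_
      (ENNReal.tsum_le_tsum fun n => h.lintegral_edist_X_succ_le ha.le hX n)
    rw [ENNReal.tsum_mul_right, ENNReal.tsum_geometric]
    have : 1 - a ≠ 0 := (tsub_pos_iff_lt.2 ha).ne'
    finiteness
  filter_upwards [h.ae_mem_pathSpace hpt,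
    ae_lt_top (Measurable.tsum hmeas) hfin] with σ hσ hlt
  exact ⟨hσ, cauchySeq_tendsto_of_complete
    (cauchySeq_of_edist_le_of_tsum_ne_top _ (fun n => le_rfl) hlt.ne)⟩

end IsWindowLimit

end MarkovSystem

/-! ### The σ-algebra of the past -/

theorem dependsOn_pastCylinder {E : Type v} (m : ℤ) (e : CodeSpace E) :
    DependsOn (· ∈ {σ : CodeSpace E | ∀ k : ℤ, m ≤ k → k ≤ 0 → σ k = e k})
      (Finset.Icc m 0 : Finset ℤ) := by
  intro σ τ h
  refine propext (forall_congr' fun k => forall_congr' fun hk => forall_congr' fun hk' => ?_)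
  rw [h k (by simp [hk, hk'])]

theorem past_le {E : Type v} [Countable E] :
    past E ≤ (MeasurableSpace.pi : MeasurableSpace (CodeSpace E)) := by
  refine MeasurableSpace.generateFrom_le ?_
  rintro _ ⟨m, -, e, rfl⟩
  exact measurableSet_setOfPred.2 (dependsOn_pastCylinder m e).measurable_of_countable

theorem isPiSystem_pastCylinders (E : Type v) :
    IsPiSystem {C | ∃ m : ℤ, m ≤ 0 ∧ ∃ e : CodeSpace E,
      C = {σ : CodeSpace E | ∀ k : ℤ, m ≤ k → k ≤ 0 → σ k = e k}} := by
  rintro _ ⟨m, hm, e, rfl⟩ _ ⟨m', hm', e', rfl⟩ ⟨τ, hτ, hτ'⟩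
  refine ⟨min m m', (min_le_left _ _).trans hm, τ, ?_⟩
  ext σ
  constructor
  · rintro ⟨h, h'⟩ k hk hk0
    rcases min_le_iff.1 hk with h1 | h1
    · rw [h k h1 hk0, hτ k h1 hk0]
    · rw [h' k h1 hk0, hτ' k h1 hk0]
  · intro h
    refine ⟨fun k hk hk0 => ?_, fun k hk hk0 => ?_⟩
    · rw [h k ((min_le_left _ _).trans hk) hk0, hτ k hk hk0]
    · rw [h k ((min_le_right _ _).trans hk) hk0, hτ' k hk hk0]

/-- The generators fix all coordinates from `m` to `0`, so fixing one coordinate is a countable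
union over the possible words on `[j, 0]`. -/
theorem measurable_past_apply {E : Type v} [Countable E] {j : ℤ} (hj : j ≤ 0) :
    Measurable[past E] fun σ : CodeSpace E => σ j := by
  let _ : MeasurableSpace (CodeSpace E) := past E
  refine measurable_to_countable' fun a => ?_
  let ext : (Finset.Icc j 0 → OnePoint E) → CodeSpace E := fun τ k =>
    if h : k ∈ Finset.Icc j 0 then τ ⟨k, h⟩ else a
  have : (fun σ : CodeSpace E => σ j) ⁻¹' {a} =
      ⋃ τ : Finset.Icc j 0 → OnePoint E, ⋃ _ : ext τ j = a,
        {σ : CodeSpace E | ∀ k : ℤ, j ≤ k → k ≤ 0 → σ k = ext τ k} := by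
    ext σ
    simp only [mem_preimage, mem_singleton_iff, mem_iUnion, exists_prop]
    constructor
    · intro h
      refine ⟨fun k => σ k, by simp [ext, hj, h], fun k hk hk0 => by simp [ext, hk, hk0]⟩
    · rintro ⟨τ, h, hσ⟩
      rw [← h]
      exact hσ j le_rfl hj
  rw [this]
  refine MeasurableSet.iUnion fun τ => MeasurableSet.iUnion fun _ => ?_
  exact MeasurableSpace.measurableSet_generateFrom ⟨j, hj, ext τ, rfl⟩

theorem _root_.DependsOn.measurable_past {E : Type v} [Countable E] {Y : Type*}
    [MeasurableSpace Y] {I : Finset ℤ} {f : CodeSpace E → Y} (hf : DependsOn f (I : Set ℤ))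
    (hI : (I : Set ℤ) ⊆ Iic 0) : Measurable[past E] f := by
  let _ : MeasurableSpace (CodeSpace E) := past E
  exact measurable_of_dependsOn (X := Unit) (f := fun _ => f) (fun _ => measurable_const)
    (fun _ => hf) (u := fun _ => ()) measurable_const (s := id)
    fun j hj => measurable_past_apply (hI hj)

/-! ### Conditional probabilities under the limit law -/

namespace MarkovSystem

variable {K : Type u} [MetricSpace K] [MeasurableSpace K] {E : Type v} {N : Type w}
  (M : MarkovSystem K E N)

variable {M} in
theorem tendsto_p_pBar (huc : M.IsUniformlyContinuous) (e : E) {x : K} {u : ℕ → K}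
    (hu : ∀ n, u n ∈ M.part (M.i e)) (hx : Tendsto u atTop (𝓝 x)) :
    Tendsto (fun n => M.p e (u n)) atTop (𝓝 (M.pBar e x)) := by
  have hcl : x ∈ closure (M.part (M.i e)) :=
    mem_closure_of_tendsto hx (Eventually.of_forall hu)
  have : (𝓝[M.part (M.i e)] x).NeBot := mem_closure_iff_nhdsWithin_neBot.1 hcl
  -- Uniform continuity preserves Cauchy filters, so the limit defining `extendFrom` exists.
  have hc : Cauchy (map (M.p e) (𝓝[M.part (M.i e)] x)) :=
    (cauchy_nhds.mono (nhdsWithin_le_nhds (s := M.part (M.i e)))).map_of_le (huc e).2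
      inf_le_right
  rw [pBar, if_pos hcl]
  exact (tendsto_extendFrom (CompleteSpace.complete hc)).comp
    (tendsto_nhdsWithin_iff.2 ⟨hx, Eventually.of_forall hu⟩)

variable {M} in
theorem tendsto_X_F {pt : N → K} {σ : CodeSpace E} (hσ : σ ∈ M.D pt) :
    Tendsto (fun n => M.X pt n σ) atTop (𝓝 (M.F pt σ)) := by
  rw [F, dif_pos hσ]
  exact hσ.2.choose_spec

variable {M} in
-- All `X n σ` lie in the vertex set of `t(σ_0)`. If this is not `i(e)`, every term is zero, even
-- when `F σ` lies in the closure of `K_{i(e)}`; hence the indicator of `T`.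
theorem tendsto_p_X (huc : M.IsUniformlyContinuous) {pt : N → K} (hpt : ∀ j, pt j ∈ M.part j)
    (e : E) {σ : CodeSpace E} (hσ : σ ∈ M.D pt) :
    Tendsto (fun n => M.p e (M.X pt n σ)) atTop
      (𝓝 ((M.T (M.i e)).indicator (fun σ => M.pBar e (M.F pt σ)) σ)) := by
  have hmem : ∀ n, M.X pt n σ ∈ M.part (M.tExt (σ 0)) := fun n =>
    PastPath.X_mem (fun j _ => (hσ.1 j).2) hpt n
  by_cases ht : M.tExt (σ 0) = M.i e
  · rw [indicator_of_mem (show σ ∈ M.T (M.i e) from ⟨hσ.1, ht⟩)]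
    exact tendsto_p_pBar huc e (fun n => ht ▸ hmem n) (tendsto_X_F hσ)
  · rw [indicator_of_notMem fun h => ht h.2]
    have : ∀ n, M.p e (M.X pt n σ) = 0 := fun n =>
      M.p_eq_zero e _ fun h => ht (eq_of_mem_part (hmem n) h)
    simp only [this]
    exact tendsto_const_nhds

variable {M} in
/-- A uniformly continuous probability function is Lipschitz up to a small additive error. -/
theorem exists_ofReal_p_le (huc : M.IsUniformlyContinuous) (e : E) {ε : ℝ≥0} (hε : 0 < ε) :
    ∃ B : ℝ≥0∞, B ≠ ∞ ∧ ∀ j, ∀ x ∈ M.part j, ∀ y ∈ M.part j,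
      ENNReal.ofReal (M.p e x) ≤ ENNReal.ofReal (M.p e y) + (ε + B * edist x y) := by
  obtain ⟨δ, hδ, h⟩ := Metric.uniformContinuousOn_iff.1 (huc e).2 ε hε
  -- With `δ` the modulus for `ε`, points at distance at least `δ` are covered by the trivial bound
  -- `1 ≤ dist / δ`.
  refine ⟨(ENNReal.ofReal δ)⁻¹, by simpa using hδ, fun j x hx y hy => ?_⟩
  by_cases hj : j = M.i e
  · subst hj
    rcases lt_or_ge (dist x y) δ with hd | hd
    · have h1 := (abs_lt.1 (h x hx y hy hd)).2
      calc ENNReal.ofReal (M.p e x) ≤ ENNReal.ofReal (M.p e y + ε) :=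
            ENNReal.ofReal_le_ofReal (by linarith)
        _ = ENNReal.ofReal (M.p e y) + ε := by
            rw [ENNReal.ofReal_add (M.p_nonneg _ _) ε.coe_nonneg, ENNReal.ofReal_coe_nnreal]
        _ ≤ _ := by gcongr; exact le_self_add
    · calc ENNReal.ofReal (M.p e x) ≤ 1 := by simpa using M.p_le_one e x
        _ = (ENNReal.ofReal δ)⁻¹ * ENNReal.ofReal δ :=
            (ENNReal.inv_mul_cancel (by simpa using hδ) ENNReal.ofReal_ne_top).symm
        _ ≤ (ENNReal.ofReal δ)⁻¹ * edist x y := by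
            rw [edist_dist]
            gcongr
        _ ≤ _ := le_add_self.trans le_add_self
  · rw [M.p_eq_zero e x fun h' => hj (eq_of_mem_part hx h')]
    simp

namespace IsWindowLimit

variable {M} {pt : N → K} {L : Filter ℕ} {Λ : Measure (CodeSpace E)}

theorem lintegral_law_one [Countable E] {A : Set (CodeSpace E)} {I : Finset ℤ}
    (hA : DependsOn (· ∈ A) (I : Set ℤ)) (hI : (I : Set ℤ) ⊆ Iic 0) (e : E) (k : ℕ)
    (hm : MeasurableSet (A ∩ {σ : CodeSpace E | σ 1 = (e : OnePoint E)})) :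
    ∫⁻ σ, (A ∩ {σ : CodeSpace E | σ 1 = (e : OnePoint E)}).indicator 1 σ ∂M.law pt k 1 =
      ∫⁻ z, A.indicator 1 z.2 * ENNReal.ofReal (M.p e z.1) ∂M.chain pt k := by
  classical
  rw [M.lintegral_law_succ pt k 0 (measurable_one.indicator hm)]
  refine lintegral_congr fun z => ?_
  rw [tsum_eq_single e]
  · rw [mul_comm]
    congr 1
    have : (fun j : ℤ => if j = ((0 : ℕ) : ℤ) + 1 then (e : OnePoint E)
        else z.2 (j - ((0 : ℕ) : ℤ))) ∈ A ↔ z.2 ∈ A := (hA fun j hj => by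
      have : j ≤ 0 := hI hj
      have : j ≠ 1 := by omega
      simp [this]).to_iff
    simp only [indicator_apply, mem_inter_iff, this]
    simp
  · intro e' he'
    rw [indicator_of_notMem]
    · simp
    · simpa using fun _ => he'

/-- Under the chain, `A` followed by `e` has probability the mean of `p e` at the position over `A`.
This differs from the mean of `G n`, a function of finitely many edges, by at most `ε + B * a ^ n *
C`, and the bound passes to `Λ`. Dominated convergence then identifies the limit of the integrals of
`G n`. -/
theorem measure_inter_eq_lintegral [Countable E] [BorelSpace K] [CompleteSpace K]
    (h : M.IsWindowLimit pt L Λ) (huc : M.IsUniformlyContinuous)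
    (hpt : ∀ j, pt j ∈ M.part j) {a C : ℝ≥0∞} (ha : a < 1) (hC : C ≠ ∞)
    (hX : ∀ k n, ∫⁻ z, edist z.1 (M.X pt n z.2) ∂M.chain pt k ≤ a ^ n * C) (e : E)
    {A : Set (CodeSpace E)} {I : Finset ℤ} (hA : DependsOn (· ∈ A) (I : Set ℤ))
    (hI : (I : Set ℤ) ⊆ Iic 0) :
    Λ (A ∩ {σ : CodeSpace E | σ 1 = (e : OnePoint E)}) =
      ∫⁻ σ in A, ENNReal.ofReal
        ((M.T (M.i e)).indicator (fun σ => M.pBar e (M.F pt σ)) σ) ∂Λ := by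
  classical
  have := h.isProbabilityMeasure
  set A₁ : Set (CodeSpace E) := A ∩ {σ : CodeSpace E | σ 1 = (e : OnePoint E)} with hA₁
  set g : CodeSpace E → ℝ := (M.T (M.i e)).indicator (fun σ => M.pBar e (M.F pt σ)) with hg
  have hAm : MeasurableSet A := measurableSet_setOfPred.2 hA.measurable_of_countable
  let I₁ : Finset ℤ := insert 1 I
  have hd₁' : DependsOn (· ∈ A₁) (I₁ : Set ℤ) := fun σ τ hστ => by
    have h1 := hA fun i hi => hστ i (by simp [I₁, Finset.mem_coe.1 hi])
    have h2 := hστ 1 (by simp [I₁])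
    simp only [hA₁, mem_inter_iff, mem_ofPred_eq, h2]
    exact congrArg (· ∧ _) h1
  have hA₁m : MeasurableSet A₁ := measurableSet_setOfPred.2 hd₁'.measurable_of_countable
  have hI₁ : (I₁ : Set ℤ) ⊆ Iic ((1 : ℕ) : ℤ) := fun i hi => by
    simp only [I₁, Finset.coe_insert, mem_insert_iff] at hi
    rcases hi with rfl | hi
    · simp
    · have : i ≤ 0 := hI hi
      simp only [mem_Iic]
      omega
  let G : ℕ → CodeSpace E → ℝ≥0∞ := fun n σ =>
    A.indicator 1 σ * ENNReal.ofReal (M.p e (M.X pt n σ))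
  let J : ℕ → Finset ℤ := fun n => I ∪ Finset.Icc (-(n : ℤ)) 0
  have hG : ∀ n, DependsOn (G n) (J n : Set ℤ) := fun n σ τ hστ => by
    have h1 := hA.indicator_one fun i hi => hστ i (by simp [J, Finset.mem_coe.1 hi])
    have h2 := M.dependsOn_X pt n fun i hi => hστ i (by
      rw [Finset.mem_coe] at hi ⊢
      exact Finset.mem_union_right _ hi)
    simp only [G, h2]
    exact congrArg (· * _) h1
  have hJ : ∀ n, (J n : Set ℤ) ⊆ Iic ((0 : ℕ) : ℤ) := fun n i hi => by
    simp only [J, Finset.coe_union, mem_union, Finset.coe_Icc, mem_Icc] at hi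
    rcases hi with hi | hi
    · exact hI hi
    · exact hi.2
  have hJ' : ∀ n, (J n : Set ℤ) ⊆ Iic ((1 : ℕ) : ℤ) := fun n =>
    (hJ n).trans (Iic_subset_Iic.2 (by simp))
  have hG1 : ∀ n σ, G n σ ≤ (1 : ℝ≥0) := fun n σ => by
    rw [ENNReal.coe_one]
    exact mul_le_one' (indicator_le_self' (by simp) _) (by simpa using M.p_le_one e _)
  have hf1 : ∀ σ, A₁.indicator (1 : CodeSpace E → ℝ≥0∞) σ ≤ (1 : ℝ≥0) := fun σ =>
    indicator_le_self' (by simp) _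
  have hGlaw : ∀ k n, ∫⁻ σ, G n σ ∂M.law pt k 1 = ∫⁻ z, G n z.2 ∂M.chain pt k := fun k n => by
    rw [M.lintegral_law_of_le pt k zero_le_one (hG n).measurable_of_countable
      ((hG n).mono (hJ n)), M.lintegral_law_zero pt k (hG n).measurable_of_countable]
  have hlim : Tendsto (fun n => ∫⁻ σ, G n σ ∂Λ) atTop
      (𝓝 (∫⁻ σ in A, ENNReal.ofReal (g σ) ∂Λ)) := by
    rw [← lintegral_indicator hAm]
    refine tendsto_lintegral_of_dominated_convergence (fun _ => 1)
      (fun n => (hG n).measurable_of_countable)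
      (fun n => ae_of_all _ fun σ => by simpa using hG1 n σ) (by simp) ?_
    filter_upwards [h.ae_mem_D hpt ha hC hX] with σ hσ
    by_cases hσA : σ ∈ A
    · simp only [G, indicator_of_mem hσA, Pi.one_apply, one_mul]
      exact ENNReal.tendsto_ofReal (tendsto_p_X huc hpt e hσ)
    · simp only [G, indicator_of_notMem hσA, zero_mul]
      exact tendsto_const_nhds
  have herr : ∀ (ε : ℝ≥0) (B : ℝ≥0∞), B ≠ ∞ →
      Tendsto (fun n : ℕ => (ε : ℝ≥0∞) + B * (a ^ n * C)) atTop (𝓝 ε) := fun ε B hB => by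
    have h1 := ENNReal.Tendsto.mul_const (b := C) (ENNReal.tendsto_pow_atTop_nhds_zero_of_lt_one
      ha) (Or.inr hC)
    have h2 := (ENNReal.Tendsto.const_mul (a := B) h1 (Or.inr hB)).const_add (ε : ℝ≥0∞)
    simpa using h2
  have hedist : ∀ n, Measurable fun z : K × CodeSpace E => edist z.1 (M.X pt n z.2) := fun n =>
    measurable_edist_window (M.dependsOn_X pt n)
  have hmeas : ∀ (ε : ℝ≥0) (B : ℝ≥0∞) (n : ℕ), Measurable fun z : K × CodeSpace E =>
      (ε : ℝ≥0∞) + B * edist z.1 (M.X pt n z.2) := fun ε B n =>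
    ((hedist n).const_mul B).const_add _
  have hint : ∀ (ε : ℝ≥0) (B : ℝ≥0∞) (k n : ℕ),
      ∫⁻ z, ((ε : ℝ≥0∞) + B * edist z.1 (M.X pt n z.2)) ∂M.chain pt k ≤ ε + B * (a ^ n * C) := by
    intro ε B k n
    rw [lintegral_add_left measurable_const, lintegral_const_mul _ (hedist n)]
    simp only [lintegral_const, measure_univ, mul_one]
    gcongr
    exact hX k n
  rw [← lintegral_indicator_one hA₁m]
  refine le_antisymm ?_ ?_
  · refine ENNReal.le_of_forall_pos_le_add fun ε hε _ => ?_
    obtain ⟨B, hB, hp⟩ := exists_ofReal_p_le huc e hε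
    refine ge_of_tendsto' (hlim.add (herr ε B hB)) fun n => ?_
    refine h.lintegral_le_of_past 1 hd₁'.indicator_one (hG n) hf1 (hG1 n) hI₁ (hJ' n) fun k => ?_
    rw [lintegral_law_one hA hI e k hA₁m, hGlaw]
    refine le_trans ?_ (add_le_add_right (hint ε B k n) _)
    rw [← lintegral_add_right _ (hmeas ε B n)]
    refine lintegral_mono_ae ?_
    filter_upwards [M.ae_compatible hpt k] with z hz
    by_cases hzA : z.2 ∈ A
    · simpa [G, hzA] using hp _ _ hz.1 _ (hz.2.X_mem hpt n)
    · simp [hzA]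
  · refine ENNReal.le_of_forall_pos_le_add fun ε hε _ => ?_
    obtain ⟨B, hB, hp⟩ := exists_ofReal_p_le huc e hε
    refine le_of_tendsto_of_tendsto' hlim ((herr ε B hB).const_add _) fun n => ?_
    refine h.lintegral_le_of_past 1 (hG n) hd₁'.indicator_one (hG1 n) hf1 (hJ' n) hI₁ fun k => ?_
    rw [lintegral_law_one hA hI e k hA₁m, hGlaw]
    refine le_trans ?_ (add_le_add_right (hint ε B k n) _)
    rw [← lintegral_add_right _ (hmeas ε B n)]
    refine lintegral_mono_ae ?_
    filter_upwards [M.ae_compatible hpt k] with z hz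
    by_cases hzA : z.2 ∈ A
    · simpa [G, hzA, edist_comm] using hp _ _ (hz.2.X_mem hpt n) _ hz.1
    · simp [G, hzA]

theorem condExp_eq [Countable E] [BorelSpace K] [CompleteSpace K]
    (h : M.IsWindowLimit pt L Λ) (huc : M.IsUniformlyContinuous)
    (hpt : ∀ j, pt j ∈ M.part j) {a C : ℝ≥0∞} (ha : a < 1) (hC : C ≠ ∞)
    (hX : ∀ k n, ∫⁻ z, edist z.1 (M.X pt n z.2) ∂M.chain pt k ≤ a ^ n * C) (e : E) :
    Λ[({σ : CodeSpace E | σ 1 = (e : OnePoint E)}).indicator (fun _ => (1 : ℝ)) | past E]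
        =ᵐ[Λ] (M.T (M.i e)).indicator (fun σ => M.pBar e (M.F pt σ)) := by
  have := h.isProbabilityMeasure
  set g : CodeSpace E → ℝ := (M.T (M.i e)).indicator (fun σ => M.pBar e (M.F pt σ)) with hg
  set A₁ : Set (CodeSpace E) := {σ : CodeSpace E | σ 1 = (e : OnePoint E)} with hA₁
  have hA₁m : MeasurableSet A₁ := (measurable_pi_apply (X := fun _ : ℤ => OnePoint E) 1)
    (MeasurableSet.of_discrete : MeasurableSet {(e : OnePoint E)})
  have hlim : ∀ᵐ σ ∂Λ, Tendsto (fun n => M.p e (M.X pt n σ)) atTop (𝓝 (g σ)) := by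
    filter_upwards [h.ae_mem_D hpt ha hC hX] with σ hσ
    exact tendsto_p_X huc hpt e hσ
  have hg01 : ∀ᵐ σ ∂Λ, 0 ≤ g σ ∧ g σ ≤ 1 := by
    filter_upwards [hlim] with σ hσ
    exact ⟨ge_of_tendsto' hσ fun n => M.p_nonneg _ _, le_of_tendsto' hσ fun n => M.p_le_one _ _⟩
  have hgm : AEStronglyMeasurable[past E] g Λ := by
    have hmeas : ∀ n, Measurable[past E] fun σ => M.p e (M.X pt n σ) := fun n =>
      DependsOn.measurable_past (I := Finset.Icc (-(n : ℤ)) 0)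
        (fun σ τ hστ => congrArg (M.p e) (M.dependsOn_X pt n hστ))
        fun i hi => by
          simp only [Finset.coe_Icc, mem_Icc] at hi
          exact hi.2
    -- The limit exists only a.e.; `limsup` is a version of it measurable with respect to the past.
    have hG : Measurable[past E] fun σ => limsup (fun n => M.p e (M.X pt n σ)) atTop := by
      let _ : MeasurableSpace (CodeSpace E) := past E
      exact Measurable.limsup hmeas
    refine ⟨_, hG.stronglyMeasurable, ?_⟩
    filter_upwards [hlim] with σ hσ
    exact hσ.limsup_eq.symm
  have hgi : Integrable g Λ := by
    refine Integrable.of_bound (hgm.mono past_le) 1 ?_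
    filter_upwards [hg01] with σ hσ
    rw [Real.norm_eq_abs, abs_of_nonneg hσ.1]
    exact hσ.2
  -- The defining identity of the conditional expectation is an equality of two finite measures on
  -- the past, so it need only be checked on the π-system of cylinders and on the whole space.
  have hcyl : (Λ.restrict A₁).trim past_le =
      (Λ.withDensity fun σ => ENNReal.ofReal (g σ)).trim past_le := by
    have key : ∀ (B : Set (CodeSpace E)) (I : Finset ℤ), DependsOn (· ∈ B) (I : Set ℤ) →
        (I : Set ℤ) ⊆ Iic 0 → MeasurableSet[past E] B →
        (Λ.restrict A₁).trim past_le B =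
          (Λ.withDensity fun σ => ENNReal.ofReal (g σ)).trim past_le B := by
      intro B I hB hI hBm
      rw [trim_measurableSet_eq _ hBm, trim_measurableSet_eq _ hBm,
        Measure.restrict_apply (past_le _ hBm), withDensity_apply _ (past_le _ hBm)]
      exact h.measure_inter_eq_lintegral huc hpt ha hC hX e hB hI
    refine @ext_of_generate_finite _ (past E) _ _ _ rfl (isPiSystem_pastCylinders E)
      (isFiniteMeasure_trim past_le) ?_
      (key univ ∅ (fun _ _ _ => rfl) (by simp) MeasurableSet.univ)
    rintro _ ⟨m, hm, τ, rfl⟩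
    refine key _ (Finset.Icc m 0) (dependsOn_pastCylinder m τ) (fun i hi => ?_)
      (MeasurableSpace.measurableSet_generateFrom ⟨m, hm, τ, rfl⟩)
    simp only [Finset.coe_Icc, mem_Icc] at hi
    exact hi.2
  refine (ae_eq_condExp_of_forall_setIntegral_eq past_le
    ((integrable_const (1 : ℝ)).indicator hA₁m) (fun s _ _ => hgi.integrableOn)
    (fun s hs _ => ?_) hgm).symm
  have hs' := past_le _ hs
  have hmeas : Λ (s ∩ A₁) = ∫⁻ σ in s, ENNReal.ofReal (g σ) ∂Λ := by
    have := congrArg (fun μ : @Measure (CodeSpace E) (past E) => μ s) hcyl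
    simpa only [trim_measurableSet_eq _ hs, Measure.restrict_apply hs',
      withDensity_apply _ hs'] using this
  rw [integral_eq_lintegral_of_nonneg_ae (ae_restrict_of_ae (hg01.mono fun _ h => h.1))
    (hgm.mono past_le).restrict, ← hmeas, setIntegral_indicator hA₁m]
  simp [Measure.real]

theorem mem_asymptoticStates [Countable E] [BorelSpace K] [CompleteSpace K]
    (h : M.IsWindowLimit pt L Λ) (huc : M.IsUniformlyContinuous)
    (hpt : ∀ j, pt j ∈ M.part j) {a C : ℝ≥0∞} (ha : a < 1) (hC : C ≠ ∞)
    (hX : ∀ k n, ∫⁻ z, edist z.1 (M.X pt n z.2) ∂M.chain pt k ≤ a ^ n * C) :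
    Λ ∈ M.asymptoticStates pt := by
  have := h.isProbabilityMeasure
  refine ⟨this, h.measurePreserving_shift, ?_, h.condExp_eq huc hpt ha hC hX⟩
  have hD : M.D pt =ᵐ[Λ] univ := eventuallyEq_univ.2 (h.ae_mem_D hpt ha hC hX)
  rw [measure_congr hD, measure_univ]

end IsWindowLimit

/-! ### Finite partitions and existence of an asymptotic state -/

variable {M} in
theorem c_lt_top_of_finite [Finite N] (hdom : M.HasDominatingChain) : M.c < ∞ := by
  have := Fintype.ofFinite N
  rw [c, tsum_fintype]
  refine ENNReal.sum_lt_top.2 fun k _ => ?_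
  refine lt_of_le_of_lt (iSup_le fun j => ?_)
    (ENNReal.sum_lt_top (s := Finset.univ) (f := M.xi) |>.2 fun j _ => hdom j)
  exact (M.xi_mul_q_le j k).trans (Finset.single_le_sum (fun _ _ => zero_le) (Finset.mem_univ j))

variable {M} in
theorem asymptoticStates_nonempty [Countable E] [Countable N] [BorelSpace K] [CompleteSpace K]
    {pt : N → K} (hpt : ∀ j, pt j ∈ M.part j) (hcontr : M.Contractive)
    (huc : M.IsUniformlyContinuous) (hb : M.b pt < ∞) (hdom : M.HasDominatingChain)
    (hc : M.c < ∞) : (M.asymptoticStates pt).Nonempty := by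
  obtain ⟨a, -, ha1, ha⟩ := hcontr
  obtain ⟨L, Λ, hΛ⟩ := exists_isWindowLimit hdom hc hpt
  have ha1' : ENNReal.ofReal a < 1 := ENNReal.ofReal_lt_one.2 ha1
  have hne : 1 - ENNReal.ofReal a ≠ 0 := (tsub_pos_iff_lt.2 ha1').ne'
  -- The fixed point of `r ↦ a * r + b`.
  let C : ℝ≥0∞ := M.b pt * (1 - ENNReal.ofReal a)⁻¹
  have hC : C ≠ ∞ := ENNReal.mul_ne_top hb.ne (ENNReal.inv_ne_top.2 hne)
  have hb' : M.b pt = (1 - ENNReal.ofReal a) * C := by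
    rw [mul_left_comm, ENNReal.mul_inv_cancel hne (by finiteness), mul_one]
  have hCle : ENNReal.ofReal a * C + M.b pt ≤ C := by
    rw [hb', ← add_mul, add_tsub_cancel_of_le ha1'.le, one_mul]
  have ha' : ∀ j, ∀ x ∈ M.part j, ∀ y ∈ M.part j,
      ∑' e, ENNReal.ofReal (M.p e x) * edist (M.w e x) (M.w e y) ≤
        ENNReal.ofReal a * edist x y := fun j x hx y hy => by
    rw [tsum_eq_tsum_subtype hx]
    exact ha j x hx y hy
  exact ⟨Λ, hΛ.mem_asymptoticStates huc hpt ha1' hC (lintegral_edist_X_le hpt ha' hCle)⟩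

end MarkovSystem

end RandomMarkov

end

theorem corollary3 {K : Type*} [MetricSpace K] [CompleteSpace K] [MeasurableSpace K] [BorelSpace K]
    {E : Type*} [Countable E] {N : Type*} [Countable N]
    (M : RandomMarkov.MarkovSystem K E N)
    (pt : N → K) (hpt : ∀ j, pt j ∈ M.part j)
    (hcontr : M.Contractive)
    (huc : M.IsUniformlyContinuous)
    (hcons : M.Consistent pt)
    (hb : M.b pt < ∞)
    (hdom : M.HasDominatingChain) :
    (M.c < ∞ → M.invariantMeasures.Nonempty) ∧
      (Finite N → M.invariantMeasures.Nonempty) := by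
  have key : M.c < ∞ → M.invariantMeasures.Nonempty := fun hc => by
    obtain ⟨Λ, hΛ⟩ :=
      RandomMarkov.MarkovSystem.asymptoticStates_nonempty hpt hcontr huc hb hdom hc
    exact ⟨_, hcons Λ hΛ⟩
  exact ⟨key, fun _ => key (RandomMarkov.MarkovSystem.c_lt_top_of_finite hdom)⟩
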